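/- Let $E$ be a finite set partitioned into classes $\delta(v)$, $v\in V$, where $V$ is a finite nonempty set of agents, let $M$ be any matroid on $E$, and let every $v\in V$ have a weak ranking $\succ_v$ (a linear order with ties) of $\delta(v)$. A common independent set is a set $I$ that is independent in $M$ and satisfies $|I\cap\delta(v)|\le 1$ for all $v$. Agent $v$ prefers $I$ to $J$ if $I$ meets $\delta(v)$ and $J$ does not, or both do and $v$ strictly prefers the element of $I\cap\delta(v)$ to that of $J\cap\delta(v)$; $\phi(I,J)$ is the number of agents preferring $I$ to $J$. A common independent set $I$ is popular if $\phi(I,J)\ge\phi(J,I)$ for all common independent sets $J$; popular common bases are defined in the same way within the set of common bases. The padded instance has the ground set $\hat E=E\cup\{e_v:v\in V\}$ with a new dummy element $e_v$ for each $v$, the classes $\hat\delta(v)=\delta(v)\cup\{e_v\}$, in which $e_v$ is strictly worse than all elements of $\delta(v)$, and the matroid $\hat M$ that is the $|V|$-truncation of the direct sum of $M$ and the free matroid on the dummy elements. For a chain $\mathcal C=\{C_1\subsetneq\dots\subsetneq C_p\}$ with $C_1\neq\emptyset$, $C_p=\hat E$, let $\mathrm{lev}(e)=\min\{i:e\in C_i\}$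 and let $\mathrm{lev}^*(v)$ be the maximum level in $\hat\delta(v)$. Let $\hat E(\mathcal C)$ be the set of all $e\in\hat\delta(v)$, $v\in V$, such that either $e$ has level $\mathrm{lev}^*(v)$ and is maximal for $v$ among the elements of $\hat\delta(v)$ of that level, or $e$ has level $\mathrm{lev}^*(v)-1$, is maximal for $v$ among the elements of $\hat\delta(v)$ of that level, and is strictly preferred by $v$ to all elements of $\hat\delta(v)$ of level $\mathrm{lev}^*(v)$. The chain $\mathcal C$ is a dual certificate for $F$ if $F\subseteq\hat E(\mathcal C)$ and $\mathrm{span}(F\cap C)=C$ in $\hat M$ for all $C\in\mathcal C$. **Theorem.** There is such a chain $\mathcal C$ that is a dual certificate for all popular common bases of the padded instance, has at most two members not counting a member equal to the set of loops of $\hat M$ (so at most two members, $\mathcal C=\{\hat E\}$ or $\mathcal C=\{C,\hat E\}$, if $M$ has no loops), and has the following properties. The points $x$ of the matroid intersection polytope of the padded instance (the convex hull of the incidence vectors of its common independent sets) with $x(\hat\delta(v))=1$ for all $v\in V$, $x(C)=\mathrm{rank}(C)$ for all $C\in\mathcal C$ and $x_e=0$ for all $e\notin\hat E(\mathcal C)$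 form a (possibly empty) face of this polytope. This face is the solution set of these equations together with $x\ge 0$ and $x(S)\le\mathrm{rank}(S)$ for all $S\subseteq\hat E$, where $\mathrm{rank}$ is the rank function of $\hat M$. Its projection to $\mathbb R^E$ (forgetting the dummy coordinates) is the convex hull of the incidence vectors of the popular common independent sets of the original instance. -/

import Mathlib

namespace PopularMatroid

/-! ### Partition matroids, truncations, the matroid intersection polytope -/

/-- The partition matroid whose parts are the colour classes `δ(v) = {e | c e = v}`:
a set is independent iff it has at most one element in every part. -/
def partitionMatroid {α V : Type*} (c : α → V) : Matroid α :=
  (Matroid.freeOn (Set.univ : Set V)).comap c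

theorem partitionMatroid_indep_iff {α V : Type*} (c : α → V) (I : Set α) :
    (partitionMatroid c).Indep I ↔ ∀ e ∈ I, ∀ f ∈ I, c e = c f → e = f := by
  simp only [partitionMatroid, Matroid.comap_indep_iff, Matroid.freeOn_indep_iff,
    Set.subset_univ, true_and]
  exact ⟨fun h e he f hf hef => h he hf hef, fun h e he f hf hef => h e he f hf hef⟩

/-- The `k`-truncation of a matroid on a finite type: all independent sets of size greater than
`k` are removed. -/
def truncation {α : Type*} [Finite α] (M : Matroid α) (k : ℕ) : Matroid α :=
  (IndepMatroid.ofFinite (E := M.E) (Set.toFinite _)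
    (fun I => M.Indep I ∧ I.ncard ≤ k)
    ⟨M.empty_indep, by simp⟩
    (fun I J hJ hIJ => ⟨hJ.1.subset hIJ, (Set.ncard_le_ncard hIJ (Set.toFinite _)).trans hJ.2⟩)
    (fun I J hI hJ hlt => by
      have hlt' : I.encard < J.encard := by
        rw [← (Set.toFinite I).cast_ncard_eq, ← (Set.toFinite J).cast_ncard_eq]
        exact_mod_cast hlt
      obtain ⟨e, he, hins⟩ := hI.1.augment hJ.1 hlt'
      refine ⟨e, he.1, he.2, hins, ?_⟩
      rw [Set.ncard_insert_of_notMem he.2 (Set.toFinite _)]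
      exact (Nat.succ_le_of_lt hlt).trans hJ.2)
    (fun I hI => hI.1.subset_ground)).matroid

theorem truncation_indep_iff {α : Type*} [Finite α] (M : Matroid α) (k : ℕ) (I : Set α) :
    (truncation M k).Indep I ↔ M.Indep I ∧ I.ncard ≤ k := Iff.rfl

/-- The rank function of a matroid on a finite type, as a natural number. -/
noncomputable def rank {α : Type*} (M : Matroid α) (S : Set α) : ℕ := (M.eRk S).toNat

/-- `I` is a common independent set of the two matroids. -/
def CommonIndep {α : Type*} (M₁ M₂ : Matroid α) (I : Set α) : Prop := M₁.Indep I ∧ M₂.Indep I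

/-- `I` is a common base of the two matroids. -/
def CommonBase {α : Type*} (M₁ M₂ : Matroid α) (I : Set α) : Prop := M₁.IsBase I ∧ M₂.IsBase I

/-- The incidence vector of a set. -/
noncomputable def incidence {α : Type*} (I : Set α) : α → ℝ := I.indicator 1

/-- The matroid intersection polytope: the convex hull of the incidence vectors of the common
independent sets. -/
def matroidIntersectionPolytope {α : Type*} (M₁ M₂ : Matroid α) : Set (α → ℝ) :=
  convexHull ℝ (incidence '' {I | CommonIndep M₁ M₂ I})

/-- `x(S) = ∑_{e ∈ S} x_e`. -/
noncomputable def sumOn {α : Type*} [Fintype α] (x : α → ℝ) (S : Set α) : ℝ :=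
  ∑ e, S.indicator x e

/-! ### Preferences and popularity

`pref e f` means that the agent `c e = c f` strictly prefers `e` to `f`; the values of `pref` on
elements of different classes are never used. -/

/-- The preferences are weak rankings (linear orders with ties): for every agent `v`, strict
preference is a strict weak order on `δ(v)`. -/
def IsWeakRanking {α V : Type*} (c : α → V) (pref : α → α → Prop) : Prop :=
  ∀ v : V, IsStrictWeakOrder {e : α // c e = v} (fun e f => pref e.1 f.1)

/-- Agent `v` prefers `I` to `J`: either `I` has an element of `δ(v)` and `J` has none, or both
have one and `v` prefers the one in `I` to the one in `J`. -/
def AgentPrefers {α V : Type*} (c : α → V) (pref : α → α → Prop) (v : V) (I J : Set α) : Prop :=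
  ((∃ e ∈ I, c e = v) ∧ ¬ ∃ f ∈ J, c f = v) ∨
    ∃ e ∈ I, ∃ f ∈ J, c e = v ∧ c f = v ∧ pref e f

/-- `φ(I, J)`: the number of agents that prefer `I` to `J`. -/
noncomputable def phi {α V : Type*} (c : α → V) (pref : α → α → Prop) (I J : Set α) : ℕ :=
  {v : V | AgentPrefers c pref v I J}.ncard

/-- `I` is a popular common independent set of the partition matroid of `c` and `M`. -/
def IsPopularCommonIndep {α V : Type*} (M : Matroid α) (c : α → V) (pref : α → α → Prop)
    (I : Set α) : Prop :=
  CommonIndep (partitionMatroid c) M I ∧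
    ∀ J, CommonIndep (partitionMatroid c) M J → phi c pref J I ≤ phi c pref I J

/-- `F` is a popular common base of the partition matroid of `c` and `M`. -/
def IsPopularCommonBase {α V : Type*} (M : Matroid α) (c : α → V) (pref : α → α → Prop)
    (F : Set α) : Prop :=
  CommonBase (partitionMatroid c) M F ∧
    ∀ J, CommonBase (partitionMatroid c) M J → phi c pref J F ≤ phi c pref F J

/-- The popular common independent set polytope: the convex hull of the incidence vectors of the
popular common independent sets. -/
def popularPolytope {α V : Type*} (M : Matroid α) (c : α → V) (pref : α → α → Prop) :
    Set (α → ℝ) :=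
  convexHull ℝ (incidence '' {I | IsPopularCommonIndep M c pref I})

/-! ### Dual certificates -/

/-- A chain `∅ ⊊ C₁ ⊊ ⋯ ⊊ C_p = E` of subsets of the ground set. -/
structure IsFullChain {α : Type*} (𝒞 : Set (Set α)) : Prop where
  chain : IsChain (· ⊆ ·) 𝒞
  empty_notMem : ∅ ∉ 𝒞
  univ_mem : Set.univ ∈ 𝒞

/-- The level of `e` in `C₁ ⊊ ⋯ ⊊ C_p = E`: the least `i` with `e ∈ C_i`, that is, one plus the
number of members of the chain that do not contain `e`. -/
noncomputable def lev {α : Type*} (𝒞 : Set (Set α)) (e : α) : ℕ :=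
  {C ∈ 𝒞 | e ∉ C}.ncard + 1

/-- The highest level of an element of `δ(v)`. -/
noncomputable def levStar {α V : Type*} (c : α → V) (𝒞 : Set (Set α)) (v : V) : ℕ :=
  sSup (lev 𝒞 '' {e | c e = v})

/-- The set `E(𝒞)`: the elements `e ∈ δ(v)` that are maximal for `v` among the elements of `δ(v)`
of level `lev*(v)`, and those that are maximal among the elements of `δ(v)` of level
`lev*(v) - 1` and strictly preferred to all elements of `δ(v)` of level `lev*(v)`. -/
def certElements {α V : Type*} (c : α → V) (pref : α → α → Prop) (𝒞 : Set (Set α)) : Set α :=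
  {e | (lev 𝒞 e = levStar c 𝒞 (c e) ∧
          ¬ ∃ e', c e' = c e ∧ lev 𝒞 e' = levStar c 𝒞 (c e) ∧ pref e' e) ∨
       (lev 𝒞 e + 1 = levStar c 𝒞 (c e) ∧
          (¬ ∃ e', c e' = c e ∧ lev 𝒞 e' + 1 = levStar c 𝒞 (c e) ∧ pref e' e) ∧
          ∀ f, c f = c e → lev 𝒞 f = levStar c 𝒞 (c e) → pref e f)}

/-- The chain `𝒞` is a dual certificate for `F`: it is a chain `∅ ⊊ C₁ ⊊ ⋯ ⊊ C_p = E` with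
`F ⊆ E(𝒞)` and `span (F ∩ C) = C` for all `C ∈ 𝒞`. -/
structure IsDualCertificate {α V : Type*} (M : Matroid α) (c : α → V) (pref : α → α → Prop)
    (𝒞 : Set (Set α)) (F : Set α) : Prop where
  fullChain : IsFullChain 𝒞
  subset_certElements : F ⊆ certElements c pref 𝒞
  span_eq : ∀ C ∈ 𝒞, M.closure (F ∩ C) = C

/-- The part of the matroid intersection polytope cut out by the chain `𝒞`: its points `x` with
`x(δ(v)) = 1` for all `v`, `x(C) = rank C` for all `C ∈ 𝒞`, and `x_e = 0` for all `e ∉ E(𝒞)`. -/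
def certFace {α V : Type*} [Fintype α] (M : Matroid α) (c : α → V) (pref : α → α → Prop)
    (𝒞 : Set (Set α)) : Set (α → ℝ) :=
  {x ∈ matroidIntersectionPolytope (partitionMatroid c) M |
    (∀ v : V, sumOn x {e | c e = v} = 1) ∧
    (∀ C ∈ 𝒞, sumOn x C = rank M C) ∧
    ∀ e, e ∉ certElements c pref 𝒞 → x e = 0}

/-- The linear system: `x ≥ 0`, `x(δ(v)) = 1` for all `v`, `x(S) ≤ rank S` for all `S`, together
with `x(C) = rank C` for all `C ∈ 𝒞` and `x_e = 0` for all `e ∉ E(𝒞)`. -/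
def certPolyhedron {α V : Type*} [Fintype α] (M : Matroid α) (c : α → V) (pref : α → α → Prop)
    (𝒞 : Set (Set α)) : Set (α → ℝ) :=
  {x | (∀ e, 0 ≤ x e) ∧
    (∀ v : V, sumOn x {e | c e = v} = 1) ∧
    (∀ S : Set α, sumOn x S ≤ rank M S) ∧
    (∀ C ∈ 𝒞, sumOn x C = rank M C) ∧
    ∀ e, e ∉ certElements c pref 𝒞 → x e = 0}

/-! ### The padded instance

Every agent `v` receives a dummy element `Sum.inr v`, which is free in the matroid and is the worst
element of `v`; the matroid is then truncated to rank `|V|`. -/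

/-- The classes of the padded instance: `δ(v)` together with the dummy element of `v`. -/
def padClass {E V : Type*} (c : E → V) : E ⊕ V → V := Sum.elim c id

/-- The preferences of the padded instance. -/
def padPref {E V : Type*} (pref : E → E → Prop) : E ⊕ V → E ⊕ V → Prop
  | Sum.inl e, Sum.inl f => pref e f
  | Sum.inl _, Sum.inr _ => True
  | Sum.inr _, _ => False

/-- The matroid of the padded instance: the `|V|`-truncation of the direct sum of `M` and the free
matroid on the dummy elements. -/
noncomputable def padMatroid {E V : Type*} [Finite E] [Finite V] (M : Matroid E) :
    Matroid (E ⊕ V) :=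
  truncation (M.sum (Matroid.freeOn (Set.univ : Set V))) (Nat.card V)

/-- The projection of `ℝ^(E ⊕ V)` to `ℝ^E` that forgets the dummy coordinates. -/
def forgetDummies {E V : Type*} (x : E ⊕ V → ℝ) : E → ℝ := fun e => x (Sum.inl e)

end PopularMatroid

open PopularMatroid

/-! Giving each unmatched agent its dummy turns common independent sets into independent sections of
the padded instance (one element per class), which are its common bases, and preserves all votes.
The votes against a fixed section `s` are linear weights, so popularity of `s` is optimality in a
linear program with integral vertices (`tightFace_subset_convexHull`), and certificates of
popularity are dual solutions.

A dual solution is found by augmentation. Call an element of `range s` reachable if it can be freed,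
up to a surplus in one class, by feasible exchanges that gain a vote. If `s` is popular, the flat
`C` spanned by the reachable elements satisfies vote(e, s(c e)) ≤ [e ∈ C] - [s(c e) ∈ C] for all
nonloops `e` (`IsPopularSection.exists_isWitness`, `IsWitness.vote_le`). Dummies are essential here:
two improvements can be completed to a section by bringing in at most one dummy, which costs at most
one vote.

Any two popular sections tie. By complementary slackness (`IsWitness.slackness`), every popular
section spans every witness of every other one, hence also the flat `witnessSpan` generated by all
witnesses together. If this flat contains the choice of a popular section for `v`, the choice is
best among the nonloops of `v`, and all nonloops tied with it lie in the flat. No element outside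
the flat beats a choice. These facts say exactly that the flat, with the loops below it and the
ground set above it, is a common dual certificate.

Conversely, for any chain, vote(e, f) ≤ lev f - lev e whenever `f` is a certificate element of the
class of `e` (`vote_add_lev_le`). Summed over the agents, this makes every section that is tight on
the chain and consists of certificate elements popular. With integrality, the linear system
therefore describes the hull of the popular sections, and forgetting dummies gives the polytope of
the original instance. -/

namespace PopularMatroid

open Set

set_option linter.unusedSectionVars false

/-! ### Natural-valued ranks. -/

section Rank

variable {α : Type*} [Fintype α] (N : Matroid α)

theorem cast_rank (S : Set α) : (rank N S : ℕ∞) = N.eRk S :=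
  ENat.natCast_toNat (ne_top_of_le_ne_top (Set.toFinite S).encard_lt_top.ne (N.eRk_le_encard S))

theorem rank_inter_add_rank_union_le (S T : Set α) :
    rank N (S ∩ T) + rank N (S ∪ T) ≤ rank N S + rank N T := by
  have h := N.eRk_inter_add_eRk_union_le S T
  simp only [← cast_rank] at h
  exact_mod_cast h

theorem rank_closure (S : Set α) : rank N (N.closure S) = rank N S := by
  simp [rank]

theorem rank_empty : rank N ∅ = 0 := by simp [rank]

variable {N}

theorem _root_.Matroid.Indep.rank_eq_ncard {I : Set α} (hI : N.Indep I) : rank N I = I.ncard := by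
  rw [rank, hI.eRk_eq_encard, Set.ncard]

theorem _root_.Matroid.Indep.ncard_le_rank {I S : Set α} (hI : N.Indep I) (h : I ⊆ S) :
    I.ncard ≤ rank N S := by
  have := hI.encard_le_eRk_of_subset h
  rw [← cast_rank, ← (Set.toFinite I).cast_ncard_eq] at this
  exact_mod_cast this

theorem _root_.Matroid.Indep.ncard_inter_le_rank {I : Set α} (hI : N.Indep I) (S : Set α) :
    (I ∩ S).ncard ≤ rank N S :=
  (hI.subset inter_subset_left).ncard_le_rank inter_subset_right

theorem rank_le_of_forall_indep {S : Set α} {n : ℕ} (h : ∀ I, N.Indep I → I.ncard ≤ n) :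
    rank N S ≤ n := by
  have : N.eRk S ≤ n := by
    rw [Matroid.eRk_le_iff]
    intro I _ hI
    rw [← (Set.toFinite I).cast_ncard_eq]
    exact_mod_cast h I hI
  rw [← cast_rank] at this
  exact_mod_cast this

theorem indep_of_ncard_le_rank {I : Set α} (h : I.ncard ≤ rank N I) : N.Indep I := by
  rw [N.indep_iff_eRk_eq_encard_of_finite (Set.toFinite I)]
  refine le_antisymm (N.eRk_le_encard I) ?_
  rw [← cast_rank, ← (Set.toFinite I).cast_ncard_eq]
  exact_mod_cast h

theorem subset_closure_inter_of_rank_le (hE : N.E = univ) {I C : Set α} (hI : N.Indep I)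
    (h : rank N C ≤ (I ∩ C).ncard) : C ⊆ N.closure (I ∩ C) := by
  have hIC : N.Indep (I ∩ C) := hI.subset inter_subset_left
  have h2 : N.eRk C ≤ N.eRk (I ∩ C) := by
    rw [← cast_rank, ← cast_rank, hIC.rank_eq_ncard]
    exact_mod_cast h
  rw [(N.isRkFinite_of_finite (Set.toFinite (I ∩ C))).closure_eq_closure_of_subset_of_eRk_ge_eRk
    inter_subset_right h2]
  exact N.subset_closure C (by simp [hE])

end Rank

/-! ### Sums of vectors over sets. -/

section SumOn

variable {α : Type*} [Fintype α]

theorem sumOn_empty (x : α → ℝ) : sumOn x ∅ = 0 := by simp [sumOn]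

theorem sumOn_inter_add_sumOn_union (x : α → ℝ) (S T : Set α) :
    sumOn x (S ∩ T) + sumOn x (S ∪ T) = sumOn x S + sumOn x T := by
  classical
  simp only [sumOn, ← Finset.sum_add_distrib]
  refine Finset.sum_congr rfl fun e _ => ?_
  by_cases hS : e ∈ S <;> by_cases hT : e ∈ T <;> simp [hS, hT]

theorem sumOn_add (x y : α → ℝ) (S : Set α) : sumOn (x + y) S = sumOn x S + sumOn y S := by
  simp [sumOn, Set.indicator_add', ← Finset.sum_add_distrib]

theorem sumOn_smul (a : ℝ) (x : α → ℝ) (S : Set α) : sumOn (a • x) S = a * sumOn x S := by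
  classical
  simp [sumOn, Finset.mul_sum, Set.indicator_apply]

theorem sumOn_incidence (I S : Set α) : sumOn (incidence I) S = (I ∩ S).ncard := by
  classical
  rw [Set.ncard_eq_toFinset_card', ← Set.filter_mem_univ_eq_toFinset, Finset.card_filter]
  simp only [sumOn, incidence, Set.indicator_apply, mem_inter_iff]
  push_cast
  refine Finset.sum_congr rfl fun e _ => ?_
  by_cases hS : e ∈ S <;> by_cases hT : e ∈ I <;> simp [hS, hT]

/-- `x ↦ x(S)` as a linear map. -/
noncomputable def sumOnLinear (S : Set α) : (α → ℝ) →ₗ[ℝ] ℝ where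
  toFun x := sumOn x S
  map_add' x y := sumOn_add x y S
  map_smul' a x := sumOn_smul a x S

theorem sumOnLinear_apply (S : Set α) (x : α → ℝ) : sumOnLinear S x = sumOn x S := rfl

theorem sumOn_sub (x y : α → ℝ) (S : Set α) : sumOn (x - y) S = sumOn x S - sumOn y S :=
  map_sub (sumOnLinear S) x y

theorem sumOn_eq_sum_filter (x : α → ℝ) (S : Set α) [DecidablePred (· ∈ S)] :
    sumOn x S = ∑ e with e ∈ S, x e := by
  classical
  rw [Finset.sum_filter]
  exact Finset.sum_congr rfl fun e _ => by simp [Set.indicator_apply]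

theorem sumOn_univ_eq_sum_classes {V : Type*} [Fintype V] (c : α → V) (x : α → ℝ) :
    sumOn x univ = ∑ v, sumOn x {e | c e = v} := by
  classical
  simp only [sumOn]
  rw [Finset.sum_comm]
  refine Finset.sum_congr rfl fun e _ => ?_
  simp [Set.indicator_apply]

end SumOn

/-! ### Kernel vectors for two colourings of the fractional elements. -/

section TwoColourings

/-- If every colour class of two colourings of a nonempty finite set has at least two elements,
there is a nonzero vector whose sums over all colour classes vanish. -/
theorem exists_ne_zero_of_two_colourings {F A B : Type*} [Fintype F] [Nonempty F]
    [Fintype A] [Fintype B] [DecidableEq A] [DecidableEq B] (a : F → A) (b : F → B)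
    (ha : ∀ i, 2 ≤ (Finset.univ.filter fun f => a f = i).card)
    (hb : ∀ j, 2 ≤ (Finset.univ.filter fun f => b f = j).card) :
    ∃ d : F → ℝ, d ≠ 0 ∧ (∀ i, ∑ f with a f = i, d f = 0) ∧ ∀ j, ∑ f with b f = j, d f = 0 := by
  classical
  let L : (F → ℝ) →ₗ[ℝ] (A ⊕ B → ℝ) :=
    { toFun := fun d => Sum.elim (fun i => ∑ f with a f = i, d f) (fun j => ∑ f with b f = j, d f)
      map_add' := by
        intro x y; ext (i | j) <;> simp [Finset.sum_add_distrib]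
      map_smul' := by
        intro r x; ext (i | j) <;> simp [Finset.mul_sum] }
  have hA : 2 * Fintype.card A ≤ Fintype.card F := by
    have h := Finset.card_eq_sum_card_fiberwise (f := a) (s := Finset.univ) (t := Finset.univ)
      (fun _ _ => by simp)
    rw [← Finset.card_univ, ← Finset.card_univ (α := F), h, mul_comm]
    exact Finset.card_nsmul_le_sum _ _ _ fun i _ => ha i
  have hB : 2 * Fintype.card B ≤ Fintype.card F := by
    have h := Finset.card_eq_sum_card_fiberwise (f := b) (s := Finset.univ) (t := Finset.univ)
      (fun _ _ => by simp)
    rw [← Finset.card_univ, ← Finset.card_univ (α := F), h, mul_comm]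
    exact Finset.card_nsmul_le_sum _ _ _ fun i _ => hb i
  -- The bounds give only |A| + |B| ≤ |F|. Injectivity would force equality and hence surjectivity,
  -- but both blocks of an image vector have the same total, so a vector with totals 1 and 0 is
  -- missed.
  have hninj : ¬ Function.Injective L := by
    intro hinj
    have hle := LinearMap.finrank_le_finrank_of_injective hinj
    simp only [Module.finrank_fintype_fun_eq_card, Fintype.card_sum] at hle
    have heq : Module.finrank ℝ (F → ℝ) = Module.finrank ℝ (A ⊕ B → ℝ) := by
      simp only [Module.finrank_fintype_fun_eq_card, Fintype.card_sum]; omega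
    have hsurj := (LinearMap.injective_iff_surjective_of_finrank_eq_finrank heq).1 hinj
    obtain ⟨f₀⟩ := ‹Nonempty F›
    obtain ⟨d, hd⟩ := hsurj (Sum.elim (fun i => if i = a f₀ then 1 else 0) 0)
    have h1 : ∑ i, ∑ f with a f = i, d f = 1 := by
      have : ∀ i, ∑ f with a f = i, d f = if i = a f₀ then 1 else 0 :=
        fun i => congrFun hd (Sum.inl i)
      simp [this]
    have h2 : ∑ j, ∑ f with b f = j, d f = 0 := by
      have : ∀ j, ∑ f with b f = j, d f = 0 := fun j => congrFun hd (Sum.inr j)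
      simp [this]
    rw [Finset.sum_fiberwise] at h1 h2
    linarith
  rw [← LinearMap.ker_eq_bot] at hninj
  obtain ⟨d, hd, hne⟩ := Submodule.exists_mem_ne_zero_of_ne_bot hninj
  rw [LinearMap.mem_ker] at hd
  exact ⟨d, hne, fun i => congrFun hd (Sum.inl i), fun j => congrFun hd (Sum.inr j)⟩

/-- A finite set of integral total weight that contains a fractional element contains two. -/
theorem two_le_card_fractional {α : Type*} (s : Finset α) (x : α → ℝ) {e : α}
    (h01 : ∀ f ∈ s, 0 ≤ x f ∧ x f ≤ 1) (he : e ∈ s) (hfrac : 0 < x e ∧ x e < 1)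
    (hint : ∃ n : ℤ, ∑ f ∈ s, x f = n) [DecidablePred fun f => 0 < x f ∧ x f < 1] :
    2 ≤ (s.filter fun f => 0 < x f ∧ x f < 1).card := by
  classical
  by_contra hlt
  have he' : e ∈ s.filter fun f => 0 < x f ∧ x f < 1 := by simp [he, hfrac]
  have hone : s.filter (fun f => 0 < x f ∧ x f < 1) = {e} := by
    refine Finset.eq_singleton_iff_unique_mem.2 ⟨he', fun f hf => ?_⟩
    exact Finset.card_le_one.1 (by omega) f hf e he'
  obtain ⟨n, hn⟩ := hint
  -- All other elements have value 0 or 1, so `x e` would be an integer strictly between 0 and 1.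
  have hrest : ∀ t : Finset α, (∀ f ∈ t, f ∈ s ∧ f ≠ e) → ∃ m : ℤ, ∑ f ∈ t, x f = m := by
    intro t
    induction t using Finset.induction_on with
    | empty => exact fun _ => ⟨0, by simp⟩
    | insert f t hft ih =>
      intro h
      obtain ⟨m, hm⟩ := ih fun g hg => h g (Finset.mem_insert_of_mem hg)
      obtain ⟨hfs, hfe⟩ := h f (Finset.mem_insert_self _ _)
      have hnf : ¬ (0 < x f ∧ x f < 1) := fun hc => hfe <| by
        have : f ∈ s.filter fun f => 0 < x f ∧ x f < 1 := Finset.mem_filter.2 ⟨hfs, hc⟩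
        simpa [hone] using this
      have h01f := h01 f hfs
      rcases h01f.1.eq_or_lt with h0 | h0
      · exact ⟨m, by rw [Finset.sum_insert hft, hm, ← h0, zero_add]⟩
      · have h1 : x f = 1 := le_antisymm h01f.2 (not_lt.1 fun h => hnf ⟨h0, h⟩)
        exact ⟨1 + m, by rw [Finset.sum_insert hft, hm, h1]; push_cast; ring⟩
  obtain ⟨m, hm⟩ := hrest (s.erase e) fun f hf => by
    rw [Finset.mem_erase] at hf; exact ⟨hf.2, hf.1⟩
  have hsum := Finset.add_sum_erase s x he
  rw [hm, hn] at hsum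
  have hx : x e = ((n - m : ℤ) : ℝ) := by push_cast; linarith
  rw [hx] at hfrac
  have h0 : (0 : ℤ) < n - m := by exact_mod_cast hfrac.1
  have h1 : n - m < (1 : ℤ) := by exact_mod_cast hfrac.2
  omega

/-- The elements at which `x` is neither `0` nor `1`. -/
abbrev Fractional {α : Type*} (x : α → ℝ) : Type _ := {f : α // 0 < x f ∧ x f < 1}

/-- Supplies the hypotheses of `exists_ne_zero_of_two_colourings`. Colours are restricted to those
occurring on fractional elements, because any other colour has an empty fractional class. -/
theorem two_le_card_fractional_fibre {α A : Type*} [Fintype α] {x : α → ℝ} (h0 : ∀ e, 0 ≤ x e)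
    (h1 : ∀ e, x e ≤ 1) (a : α → A) [DecidableEq (range fun f : Fractional x => a f.1)]
    [Fintype (Fractional x)]
    (h : ∀ f : Fractional x, ∃ n : ℤ, sumOn x {g | a g = a f.1} = n)
    (i : range fun f : Fractional x => a f.1) :
    2 ≤ (Finset.univ.filter fun f : Fractional x =>
      rangeFactorization (fun f : Fractional x => a f.1) f = i).card := by
  classical
  obtain ⟨_, f, rfl⟩ := i
  obtain ⟨n, hn⟩ := h f
  rw [sumOn_eq_sum_filter] at hn
  have := two_le_card_fractional (Finset.univ.filter fun g => g ∈ {g | a g = a f.1}) x (e := f.1)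
    (fun g _ => ⟨h0 g, h1 g⟩) (by simp) f.2 ⟨n, hn⟩
  refine this.trans (le_of_eq ?_)
  symm
  refine Finset.card_bij (fun g _ => g.1) ?_ ?_ ?_
  · intro g hg
    simp only [Finset.mem_filter, Finset.mem_univ, true_and, Subtype.ext_iff,
      rangeFactorization_coe] at hg
    simpa using ⟨hg, g.2⟩
  · intro g _ g' _ h; exact Subtype.ext h
  · intro g hg
    simp only [Finset.mem_filter, Finset.mem_univ, true_and, mem_ofPred_eq] at hg
    refine ⟨⟨g, hg.2⟩, ?_, rfl⟩
    simp only [Finset.mem_filter, Finset.mem_univ, true_and, Subtype.ext_iff,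
      rangeFactorization_coe]
    exact hg.1

theorem sumOn_extend_fibre {α A : Type*} [Fintype α] {x : α → ℝ} (a : α → A)
    [DecidableEq (range fun f : Fractional x => a f.1)] [Fintype (Fractional x)]
    [∀ f, Decidable (0 < x f ∧ x f < 1)] {d : Fractional x → ℝ}
    (h : ∀ i : range (fun f : Fractional x => a f.1),
      ∑ f with rangeFactorization (fun f : Fractional x => a f.1) f = i, d f = 0) (i : A) :
    sumOn (fun f => if h : 0 < x f ∧ x f < 1 then d ⟨f, h⟩ else 0) {g | a g = i} = 0 := by
  classical
  have hs : sumOn (fun f => if h : 0 < x f ∧ x f < 1 then d ⟨f, h⟩ else 0) {g | a g = i} =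
      ∑ f : Fractional x with a f.1 = i, d f := by
    rw [sumOn_eq_sum_filter]
    rw [← Finset.sum_filter_add_sum_filter_not _ (fun g => 0 < x g ∧ x g < 1)]
    rw [Finset.sum_eq_zero (s := Finset.filter (fun g => ¬ _) _), add_zero]
    · symm
      refine Finset.sum_bij (fun g _ => g.1) ?_ ?_ ?_ ?_
      · intro g hg; simpa using ⟨by simpa using hg, g.2⟩
      · intro g _ g' _ h; exact Subtype.ext h
      · intro g hg
        simp only [Finset.mem_filter, Finset.mem_univ, true_and, mem_ofPred_eq] at hg
        exact ⟨⟨g, hg.2⟩, by simp [hg.1], rfl⟩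
      · intro g hg; simp [g.2]
    · intro g hg
      simp only [Finset.mem_filter] at hg
      simp only [dif_neg hg.2]
  rw [hs]
  by_cases hi : i ∈ range (fun f : Fractional x => a f.1)
  · refine (Finset.sum_congr ?_ fun _ _ => rfl).trans (h ⟨i, hi⟩)
    ext f
    simp [Subtype.ext_iff, rangeFactorization_coe]
  · refine Finset.sum_eq_zero fun f hf => absurd ⟨f, ?_⟩ hi
    simpa using hf

end TwoColourings

/-! ### Integrality of the faces, by uncrossing tight sets at extreme points. -/

section Integrality

variable {α V : Type*} [Fintype α] [Fintype V] {N : Matroid α} {c : α → V}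

/-- The face of the matroid base polytope intersected with the assignment constraints of `c` in
which the members of `𝒞` are tight and the coordinates outside `Z` vanish. -/
def tightFace (N : Matroid α) (c : α → V) (𝒞 : Set (Set α)) (Z : Set α) : Set (α → ℝ) :=
  {x | (∀ e, 0 ≤ x e) ∧
    (∀ v : V, sumOn x {e | c e = v} = 1) ∧
    (∀ S : Set α, sumOn x S ≤ rank N S) ∧
    (∀ C ∈ 𝒞, sumOn x C = rank N C) ∧
    ∀ e, e ∉ Z → x e = 0}

variable {𝒞 : Set (Set α)} {Z : Set α}

theorem le_one_of_sumOn_class {x : α → ℝ} (h0 : ∀ e, 0 ≤ x e)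
    (h1 : ∀ v : V, sumOn x {e | c e = v} = 1) (e : α) : x e ≤ 1 := by
  rw [← h1 (c e)]
  have := Finset.single_le_sum (f := fun f => {f | c f = c e}.indicator x f) (s := Finset.univ)
    (fun f _ => Set.indicator_nonneg (fun f _ => h0 f) f) (Finset.mem_univ e)
  simpa [sumOn] using this

theorem continuous_sumOn (S : Set α) : Continuous fun x : α → ℝ => sumOn x S :=
  (sumOnLinear S).continuous_of_finiteDimensional

theorem convex_tightFace : Convex ℝ (tightFace N c 𝒞 Z) := by
  rintro x ⟨hx0, hx1, hx2, hx3, hx4⟩ y ⟨hy0, hy1, hy2, hy3, hy4⟩ a b ha hb hab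
  refine ⟨fun e => ?_, fun v => ?_, fun S => ?_, fun C hC => ?_, fun e he => ?_⟩
  · exact add_nonneg (mul_nonneg ha (hx0 e)) (mul_nonneg hb (hy0 e))
  · rw [sumOn_add, sumOn_smul, sumOn_smul, hx1, hy1]; linarith
  · rw [sumOn_add, sumOn_smul, sumOn_smul]
    calc a * sumOn x S + b * sumOn y S ≤ a * rank N S + b * rank N S := by
          gcongr
          · exact hx2 S
          · exact hy2 S
      _ = rank N S := by rw [← add_mul, hab, one_mul]
  · rw [sumOn_add, sumOn_smul, sumOn_smul, hx3 C hC, hy3 C hC, ← add_mul, hab, one_mul]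
  · simp [hx4 e he, hy4 e he]

theorem isCompact_tightFace : IsCompact (tightFace N c 𝒞 Z) := by
  have hsub : tightFace N c 𝒞 Z ⊆ Icc 0 1 := fun x hx =>
    ⟨fun e => hx.1 e, fun e => le_one_of_sumOn_class hx.1 hx.2.1 e⟩
  refine isCompact_Icc.of_isClosed_subset ?_ hsub
  simp only [tightFace, ofPred_and, ofPred_forall]
  refine IsClosed.inter ?_ (IsClosed.inter ?_ (IsClosed.inter ?_ (IsClosed.inter ?_ ?_)))
  · exact isClosed_iInter fun e => isClosed_le continuous_const (continuous_apply e)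
  · exact isClosed_iInter fun v => isClosed_eq (continuous_sumOn _) continuous_const
  · exact isClosed_iInter fun v => isClosed_le (continuous_sumOn _) continuous_const
  · exact isClosed_iInter fun C => isClosed_iInter fun _ =>
      isClosed_eq (continuous_sumOn _) continuous_const
  · exact isClosed_iInter fun e => isClosed_iInter fun _ =>
      isClosed_eq (continuous_apply e) continuous_const

/-- The sets at which the rank inequality of `x` is an equality. -/
def IsTight (N : Matroid α) (x : α → ℝ) (S : Set α) : Prop := sumOn x S = rank N S

theorem IsTight.inter_union {x : α → ℝ} (hx : ∀ S, sumOn x S ≤ rank N S) {S T : Set α}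
    (hS : IsTight N x S) (hT : IsTight N x T) : IsTight N x (S ∩ T) ∧ IsTight N x (S ∪ T) := by
  have h1 := sumOn_inter_add_sumOn_union x S T
  have h2 : (rank N (S ∩ T) : ℝ) + rank N (S ∪ T) ≤ rank N S + rank N T := by
    exact_mod_cast rank_inter_add_rank_union_le N S T
  have h3 := hx (S ∩ T)
  have h4 := hx (S ∪ T)
  simp only [IsTight] at *
  constructor <;> linarith

theorem isTight_sUnion {x : α → ℝ} (hx : ∀ S, sumOn x S ≤ rank N S) {𝒯 : Set (Set α)}
    (h : ∀ S ∈ 𝒯, IsTight N x S) : IsTight N x (⋃₀ 𝒯) := by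
  induction 𝒯, 𝒯.toFinite using Set.Finite.induction_on with
  | empty => simp [IsTight, sumOn_empty, rank_empty]
  | insert _ _ ih =>
    rw [sUnion_insert]
    exact ((h _ (mem_insert _ _)).inter_union hx
      (ih fun S hS => h S (mem_insert_of_mem _ hS))).2

theorem isTight_sInter {x : α → ℝ} (hx : ∀ S, sumOn x S ≤ rank N S) (huniv : IsTight N x univ)
    {𝒯 : Set (Set α)} (h : ∀ S ∈ 𝒯, IsTight N x S) : IsTight N x (⋂₀ 𝒯) := by
  induction 𝒯, 𝒯.toFinite using Set.Finite.induction_on with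
  | empty => simpa using huniv
  | insert _ _ ih =>
    rw [sInter_insert]
    exact ((h _ (mem_insert _ _)).inter_union hx
      (ih fun S hS => h S (mem_insert_of_mem _ hS))).1

/-- The smallest tight set that contains `e`. -/
def tightHull (N : Matroid α) (x : α → ℝ) (e : α) : Set α := ⋂₀ {S | IsTight N x S ∧ e ∈ S}

theorem mem_tightHull_self (x : α → ℝ) (e : α) : e ∈ tightHull N x e := fun _ hS => hS.2

theorem tightHull_subset {x : α → ℝ} {e : α} {S : Set α} (hS : IsTight N x S) (he : e ∈ S) :
    tightHull N x e ⊆ S := sInter_subset_of_mem ⟨hS, he⟩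

theorem isTight_tightHull {x : α → ℝ} (hx : ∀ S, sumOn x S ≤ rank N S)
    (huniv : IsTight N x univ) (e : α) : IsTight N x (tightHull N x e) :=
  isTight_sInter hx huniv fun _ hS => hS.1

/-- The elements with the same hull as `e` form the hull of `e` minus the union of the hulls of
those of its elements whose hull misses `e`. Both sets are tight, so the sum is a difference of two
ranks. -/
theorem tightHull_fibre_sum {x : α → ℝ} (hx : ∀ S, sumOn x S ≤ rank N S)
    (huniv : IsTight N x univ) (e : α) :
    ∃ n : ℤ, sumOn x {f | tightHull N x f = tightHull N x e} = n := by
  set D := tightHull N x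
  have hD := isTight_tightHull hx huniv
  let 𝒯 : Set (Set α) := {S | ∃ f ∈ D e, e ∉ D f ∧ S = D f}
  have hU : IsTight N x (⋃₀ 𝒯) := isTight_sUnion hx (by rintro _ ⟨f, -, -, rfl⟩; exact hD f)
  have hdisj : {f | D f = D e} ∩ ⋃₀ 𝒯 = ∅ := by
    rw [Set.eq_empty_iff_forall_notMem]
    rintro g ⟨hg, _, ⟨f, hf, hef, rfl⟩, hgf⟩
    refine hef (tightHull_subset (hD f) hgf ?_)
    rw [show tightHull N x g = D e from hg]
    exact mem_tightHull_self x e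
  have hunion : {f | D f = D e} ∪ ⋃₀ 𝒯 = D e := by
    ext g
    constructor
    · rintro (hg | ⟨_, ⟨f, hf, hef, rfl⟩, hgf⟩)
      · rw [← show D g = D e from hg]; exact mem_tightHull_self x g
      · exact tightHull_subset (hD e) hf hgf
    · intro hg
      by_cases he : e ∈ D g
      · exact Or.inl ((tightHull_subset (hD e) hg).antisymm (tightHull_subset (hD g) he))
      · exact Or.inr ⟨D g, ⟨g, hg, he, rfl⟩, mem_tightHull_self x g⟩
  have h := sumOn_inter_add_sumOn_union x {f | D f = D e} (⋃₀ 𝒯)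
  rw [hdisj, hunion, sumOn_empty] at h
  have h1 := hD e
  simp only [IsTight] at h1 hU
  refine ⟨(rank N (D e) : ℤ) - rank N (⋃₀ 𝒯), ?_⟩
  push_cast
  rw [← h1, ← hU]
  linarith

/-- A vector with vanishing sums over the classes of equal tight hull vanishes on tight sets. -/
theorem sumOn_eq_zero_of_isTight {x d : α → ℝ}
    (hd : ∀ e, sumOn d {f | tightHull N x f = tightHull N x e} = 0) {S : Set α}
    (hS : IsTight N x S) : sumOn d S = 0 := by
  classical
  have h1 : sumOn d S = ∑ T : Set α, sumOn d (S ∩ {f | tightHull N x f = T}) := by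
    simp only [sumOn]
    rw [Finset.sum_comm]
    refine Finset.sum_congr rfl fun e _ => ?_
    by_cases he : e ∈ S <;> simp [Set.indicator_apply, he]
  rw [h1]
  refine Finset.sum_eq_zero fun T _ => ?_
  by_cases hT : ∃ e ∈ S, tightHull N x e = T
  · obtain ⟨e, he, rfl⟩ := hT
    rw [inter_eq_self_of_subset_right, hd e]
    intro f hf
    refine tightHull_subset hS he ?_
    rw [← show tightHull N x f = tightHull N x e from hf]
    exact mem_tightHull_self x f
  · rw [show S ∩ {f | tightHull N x f = T} = ∅ from
      eq_empty_of_forall_notMem fun f hf => hT ⟨f, hf.1, hf.2⟩, sumOn_empty]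

/-- The classes contribute |V| in total, and no rank exceeds |V|. This makes an intersection of
tight sets tight even when the family is empty. -/
theorem isTight_univ (hcard : ∀ I, N.Indep I → I.ncard ≤ Fintype.card V) {x : α → ℝ}
    (h1 : ∀ v : V, sumOn x {e | c e = v} = 1) (h2 : ∀ S, sumOn x S ≤ rank N S) :
    IsTight N x univ := by
  refine le_antisymm (h2 univ) ?_
  rw [sumOn_univ_eq_sum_classes c]
  simp only [h1, Finset.sum_const, Finset.card_univ, nsmul_eq_mul, mul_one]
  exact_mod_cast rank_le_of_forall_indep hcard

/-- Small perturbations of a point of `tightFace` in directions that keep its tight constraints. -/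
theorem exists_perturbation {x d : α → ℝ} (hx : x ∈ tightFace N c 𝒞 Z)
    (hpos : ∀ e, x e = 0 → d e = 0) (hclass : ∀ v : V, sumOn d {e | c e = v} = 0)
    (htight : ∀ S, IsTight N x S → sumOn d S = 0) :
    ∃ ε : ℝ, 0 < ε ∧ x + ε • d ∈ tightFace N c 𝒞 Z := by
  obtain ⟨hx0, hx1, hx2, hx3, hx4⟩ := hx
  -- The direction does not affect tight constraints; the others are finitely many strict
  -- inequalities, which survive for small ε.
  have hev1 : ∀ᶠ ε : ℝ in nhdsWithin 0 (Ioi 0), ∀ e, 0 ≤ x e + ε * d e := by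
    rw [Filter.eventually_all]
    intro e
    rcases (hx0 e).eq_or_lt with h | h
    · exact Filter.Eventually.of_forall fun ε => by rw [← h, hpos e h.symm]; simp
    · have : Filter.Tendsto (fun ε : ℝ => x e + ε * d e) (nhdsWithin 0 (Ioi 0))
          (nhds (x e + 0 * d e)) :=
        (Continuous.tendsto (by fun_prop) 0).mono_left nhdsWithin_le_nhds
      rw [zero_mul, add_zero] at this
      exact (this.eventually (lt_mem_nhds h)).mono fun _ => le_of_lt
  have hev2 : ∀ᶠ ε : ℝ in nhdsWithin 0 (Ioi 0), ∀ S, sumOn x S + ε * sumOn d S ≤ rank N S := by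
    rw [Filter.eventually_all]
    intro S
    rcases (hx2 S).eq_or_lt with h | h
    · exact Filter.Eventually.of_forall fun ε => by rw [htight S h, h]; simp
    · have : Filter.Tendsto (fun ε : ℝ => sumOn x S + ε * sumOn d S) (nhdsWithin 0 (Ioi 0))
          (nhds (sumOn x S + 0 * sumOn d S)) :=
        (Continuous.tendsto (by fun_prop) 0).mono_left nhdsWithin_le_nhds
      rw [zero_mul, add_zero] at this
      exact (this.eventually (gt_mem_nhds h)).mono fun _ => le_of_lt
  obtain ⟨ε, ⟨h1, h2⟩, hε⟩ := ((hev1.and hev2).and self_mem_nhdsWithin).exists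
  refine ⟨ε, hε, h1, fun v => ?_, fun S => ?_, fun C hC => ?_, fun e he => ?_⟩
  · rw [sumOn_add, sumOn_smul, hx1, hclass]; simp
  · rw [sumOn_add, sumOn_smul]; exact h2 S
  · rw [sumOn_add, sumOn_smul, htight C (hx3 C hC), hx3 C hC]; simp
  · simp [hx4 e he, hpos e (hx4 e he)]

/-- Agent classes and classes of equal hull have integral sums, so each one that meets the
fractional support meets it twice. The resulting kernel vector preserves all tight constraints, and
`x` can be moved both ways along it. -/
theorem eq_zero_or_one_of_mem_extremePoints
    (hcard : ∀ I, N.Indep I → I.ncard ≤ Fintype.card V) {x : α → ℝ}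
    (hx : x ∈ (tightFace N c 𝒞 Z).extremePoints ℝ) (e : α) : x e = 0 ∨ x e = 1 := by
  classical
  have hxm := hx.1
  obtain ⟨hx0, hx1, hx2, hx3, hx4⟩ := hx.1
  have hle := le_one_of_sumOn_class hx0 hx1
  have huniv := isTight_univ hcard hx1 hx2
  by_contra hne
  push Not at hne
  have heF : 0 < x e ∧ x e < 1 := ⟨(hx0 e).lt_of_ne' hne.1, (hle e).lt_of_ne hne.2⟩
  have : Nonempty (Fractional x) := ⟨⟨e, heF⟩⟩
  obtain ⟨d, hd0, hda, hdb⟩ := exists_ne_zero_of_two_colourings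
    (rangeFactorization fun f : Fractional x => c f.1)
    (rangeFactorization fun f : Fractional x => tightHull N x f.1)
    (two_le_card_fractional_fibre hx0 hle c fun f => ⟨1, by rw [hx1]; simp⟩)
    (two_le_card_fractional_fibre hx0 hle (tightHull N x) fun f => tightHull_fibre_sum hx2 huniv f.1)
  let d' : α → ℝ := fun f => if h : 0 < x f ∧ x f < 1 then d ⟨f, h⟩ else 0
  have hclass := sumOn_extend_fibre c hda
  have hhull := sumOn_extend_fibre (tightHull N x) hdb
  have htight : ∀ S, IsTight N x S → sumOn d' S = 0 := fun S hS =>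
    sumOn_eq_zero_of_isTight (fun e => hhull _) hS
  have hpos : ∀ f, x f = 0 → d' f = 0 := fun f hf => by simp [d', hf]
  obtain ⟨ε, hε, h1⟩ := exists_perturbation hxm hpos hclass htight
  obtain ⟨δ, hδ, h2⟩ := exists_perturbation (d := -d') hxm (fun f hf => by simp [hpos f hf])
    (fun v => by rw [← zero_sub, sumOn_sub, hclass]; simp [sumOn])
    (fun S hS => by rw [← zero_sub, sumOn_sub, htight S hS]; simp [sumOn])
  -- The weights are chosen so that the two displacements, of lengths ε and δ, cancel.
  have hseg : x ∈ openSegment ℝ (x + ε • d') (x + δ • -d') := by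
    refine ⟨δ / (ε + δ), ε / (ε + δ), by positivity, by positivity, by field_simp; ring, ?_⟩
    ext f
    simp only [Pi.add_apply, Pi.smul_apply, Pi.neg_apply, smul_eq_mul]
    field_simp
    ring
  have := hx.2 h1 h2 hseg
  refine hd0 (funext fun f => ?_)
  have h3 := congrFun this f.1
  simp only [Pi.add_apply, Pi.smul_apply, smul_eq_mul, add_eq_left, mul_eq_zero] at h3
  have h4 := h3.resolve_left hε.ne'
  simpa [d', f.2] using h4

/-- The points of the system are the convex combinations of its integral points. -/
theorem tightFace_subset_convexHull (hcard : ∀ I, N.Indep I → I.ncard ≤ Fintype.card V) :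
    tightFace N c 𝒞 Z ⊆ convexHull ℝ (incidence '' {F | ∃ s : V → α, (∀ v, c (s v) = v) ∧
      F = range s ∧ N.Indep F ∧ (∀ C ∈ 𝒞, (F ∩ C).ncard = rank N C) ∧ F ⊆ Z}) := by
  classical
  -- Krein–Milman; the closure is harmless since the hull of finitely many points is closed.
  rw [← closure_convexHull_extremePoints isCompact_tightFace convex_tightFace]
  have hfin : (incidence '' {F | ∃ s : V → α, (∀ v, c (s v) = v) ∧
      F = range s ∧ N.Indep F ∧ (∀ C ∈ 𝒞, (F ∩ C).ncard = rank N C) ∧ F ⊆ Z}).Finite :=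
    (Set.toFinite _).image _
  refine closure_minimal (convexHull_mono ?_) (hfin.isClosed_convexHull ℝ)
  intro x hx
  have h01 := eq_zero_or_one_of_mem_extremePoints hcard hx
  obtain ⟨hx0, hx1, hx2, hx3, hx4⟩ := hx.1
  set F := {e | x e = 1} with hF
  have hxF : incidence F = x := by
    ext e
    rcases h01 e with h | h <;> simp [incidence, hF, h]
  have hsum : ∀ S, sumOn x S = (F ∩ S).ncard := fun S => by
    rw [← sumOn_incidence, hxF]
  have hone : ∀ v, ∃ e, F ∩ {e | c e = v} = {e} := fun v => by
    rw [← Set.ncard_eq_one]; exact_mod_cast (hsum _).symm.trans (hx1 v)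
  choose s hs using hone
  have hsm : ∀ v, s v ∈ F ∩ {e | c e = v} := fun v => by rw [hs v]; rfl
  refine ⟨F, ⟨s, fun v => (hsm v).2, ?_, ?_, fun C hC => ?_, fun e he => ?_⟩, hxF⟩
  · ext e
    constructor
    · intro he
      have : e ∈ F ∩ {f | c f = c e} := ⟨he, rfl⟩
      rw [hs] at this
      exact ⟨c e, this.symm⟩
    · rintro ⟨v, rfl⟩; exact (hsm v).1
  · apply indep_of_ncard_le_rank
    have := hx2 F
    rw [hsum, inter_self] at this
    exact_mod_cast this
  · have := hx3 C hC
    rw [hsum] at this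
    exact_mod_cast this
  · by_contra hZ
    have h1 : x e = 1 := he
    rw [hx4 e hZ] at h1
    norm_num at h1

end Integrality

/-! ### Weak rankings and votes. -/

section WeakRanking

variable {α V : Type*} {c : α → V} {pref : α → α → Prop}

theorem IsWeakRanking.irrefl (h : IsWeakRanking c pref) (a : α) : ¬ pref a a :=
  (h (c a)).irrefl ⟨a, rfl⟩

theorem IsWeakRanking.trans (h : IsWeakRanking c pref) {a b e : α} (hab : c a = c b)
    (hbe : c b = c e) (h1 : pref a b) (h2 : pref b e) : pref a e :=
  (h (c a)).trans ⟨a, rfl⟩ ⟨b, hab.symm⟩ ⟨e, (hab.trans hbe).symm⟩ h1 h2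

theorem IsWeakRanking.asymm (h : IsWeakRanking c pref) {a b : α} (hab : c a = c b)
    (h1 : pref a b) : ¬ pref b a := fun h2 => h.irrefl a (h.trans hab hab.symm h1 h2)

theorem IsWeakRanking.incomp_trans (h : IsWeakRanking c pref) {a b e : α} (hab : c a = c b)
    (hbe : c b = c e) (h1 : ¬ pref a b ∧ ¬ pref b a) (h2 : ¬ pref b e ∧ ¬ pref e b) :
    ¬ pref a e ∧ ¬ pref e a :=
  (h (c a)).incomp_trans ⟨a, rfl⟩ ⟨b, hab.symm⟩ ⟨e, (hab.trans hbe).symm⟩ h1 h2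

theorem IsWeakRanking.of_pref_of_incomp (h : IsWeakRanking c pref) {a b e : α} (hab : c a = c b)
    (hbe : c b = c e) (h1 : pref a b) (h2 : ¬ pref b e ∧ ¬ pref e b) : pref a e := by
  by_contra hae
  by_cases hea : pref e a
  · exact h2.2 (h.trans (hab.trans hbe).symm hab hea h1)
  · exact (h.incomp_trans (hab.trans hbe) hbe.symm ⟨hae, hea⟩ h2.symm).1 h1

theorem IsWeakRanking.of_incomp_of_pref (h : IsWeakRanking c pref) {a b e : α} (hab : c a = c b)
    (hbe : c b = c e) (h1 : ¬ pref a b ∧ ¬ pref b a) (h2 : pref b e) : pref a e := by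
  by_contra hae
  by_cases hea : pref e a
  · exact h1.2 (h.trans hbe (hab.trans hbe).symm h2 hea)
  · exact (h.incomp_trans hab.symm (hab.trans hbe) h1.symm ⟨hae, hea⟩).1 h2

open Classical in
/-- The vote between `a` and `b`: `1` if `a` is preferred, `-1` if `b` is, and `0` for a tie. -/
noncomputable def vote (pref : α → α → Prop) (a b : α) : ℝ :=
  if pref a b then 1 else if pref b a then -1 else 0

theorem vote_of_pref {a b : α} (h : pref a b) : vote pref a b = 1 := if_pos h

theorem vote_of_tie {a b : α} (h : ¬ pref a b ∧ ¬ pref b a) : vote pref a b = 0 := by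
  simp [vote, h.1, h.2]

theorem IsWeakRanking.vote_of_pref' (h : IsWeakRanking c pref) {a b : α} (hab : c a = c b)
    (hba : pref b a) : vote pref a b = -1 := by
  simp [vote, hba, h.asymm hab.symm hba]

theorem IsWeakRanking.vote_self (h : IsWeakRanking c pref) (a : α) : vote pref a a = 0 :=
  vote_of_tie ⟨h.irrefl a, h.irrefl a⟩

theorem neg_one_le_vote (a b : α) : -1 ≤ vote pref a b := by
  unfold vote; split_ifs <;> norm_num

theorem vote_le_one (a b : α) : vote pref a b ≤ 1 := by
  unfold vote; split_ifs <;> norm_num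

theorem vote_nonpos_of_not_pref {a b : α} (h : ¬ pref a b) : vote pref a b ≤ 0 := by
  unfold vote; split_ifs <;> norm_num

theorem IsWeakRanking.vote_swap (h : IsWeakRanking c pref) {a b : α} (hab : c a = c b) :
    vote pref b a = - vote pref a b := by
  by_cases h1 : pref a b
  · rw [vote_of_pref h1, h.vote_of_pref' hab.symm h1]
  · by_cases h2 : pref b a
    · rw [vote_of_pref h2, h.vote_of_pref' hab h2, neg_neg]
    · rw [vote_of_tie ⟨h1, h2⟩, vote_of_tie ⟨h2, h1⟩, neg_zero]

end WeakRanking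

/-! ### Independent sections and popularity. -/

section Sections

variable {α V : Type*} [Fintype α] [Fintype V]

/-- `s` chooses one element of every class, and the chosen elements are independent. -/
structure IsIndepSection (N : Matroid α) (c : α → V) (s : V → α) : Prop where
  class_eq : ∀ v, c (s v) = v
  indep : N.Indep (range s)

/-- An independent section that loses no head-to-head election against an independent section. -/
structure IsPopularSection (N : Matroid α) (c : α → V) (pref : α → α → Prop) (s : V → α) : Prop
    extends IsIndepSection N c s where
  sum_vote_le : ∀ t, IsIndepSection N c t → ∑ v, vote pref (t v) (s v) ≤ 0

variable {N : Matroid α} {c : α → V} {pref : α → α → Prop} {s t : V → α}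

theorem IsIndepSection.injective (hs : IsIndepSection N c s) : Function.Injective s :=
  fun u v h => by rw [← hs.class_eq u, h, hs.class_eq]

theorem IsIndepSection.mem_range_iff (hs : IsIndepSection N c s) {e : α} :
    e ∈ range s ↔ s (c e) = e :=
  ⟨by rintro ⟨v, rfl⟩; rw [hs.class_eq], fun h => ⟨_, h⟩⟩

theorem IsIndepSection.ncard_range (hs : IsIndepSection N c s) :
    (range s).ncard = Fintype.card V := by
  rw [← image_univ, ncard_image_of_injective _ hs.injective, ncard_univ, Nat.card_eq_fintype_card]

open Classical in
theorem IsIndepSection.sum_ite_mem (hs : IsIndepSection N c s) (C : Set α) :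
    ∑ v, (if s v ∈ C then (1 : ℝ) else 0) = (range s ∩ C).ncard := by
  rw [inter_comm, ← image_preimage_eq_inter_range, ncard_image_of_injective _ hs.injective,
    ncard_eq_toFinset_card', Finset.sum_boole]
  congr 2
  ext v
  simp

theorem IsIndepSection.isBase (hcard : ∀ I, N.Indep I → I.ncard ≤ Fintype.card V)
    (hs : IsIndepSection N c s) : N.IsBase (range s) := by
  rw [Matroid.isBase_iff_maximal_indep, maximal_subset_iff]
  exact ⟨hs.indep, fun J hJ h => Set.eq_of_subset_of_ncard_le h
    ((hcard J hJ).trans hs.ncard_range.ge) (Set.toFinite J)⟩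

end Sections

/-- The properties of the dummy elements of a padded instance: `d v` is a dummy element of the
agent `v`, and dummy elements can be exchanged freely as the matroid is a truncation. -/
structure IsPadding {α V : Type*} [Fintype V] (N : Matroid α) (c : α → V) (d : V → α) : Prop where
  ground_eq : N.E = univ
  ncard_le : ∀ I, N.Indep I → I.ncard ≤ Fintype.card V
  class_eq : ∀ v, c (d v) = v
  exchange : ∀ s : V → α, (∀ v, c (s v) = v) → N.Indep (range s) → ∀ u v, s v ≠ d v →
    N.Indep (insert (d v) (range s \ {s u}))
  exchange' : ∀ s : V → α, (∀ v, c (s v) = v) → N.Indep (range s) → ∀ v, s v = d v →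
    ∀ e, e ∉ range s → N.Indep (insert e (range s \ {s v})) → ∀ u,
    N.Indep (insert e (range s \ {s u}))

/-! ### Feasible directions and base exchanges. -/

section Directions

variable {α V : Type*} [Fintype α] [Fintype V]

/-- The sums of a vector over the classes. -/
noncomputable def classSum (c : α → V) : (α → ℝ) →ₗ[ℝ] (V → ℝ) :=
  LinearMap.pi fun v => sumOnLinear {e | c e = v}

/-- The linear functional with coefficients `w`. -/
noncomputable def weightSum (w : α → ℝ) : (α → ℝ) →ₗ[ℝ] ℝ where
  toFun x := ∑ e, w e * x e
  map_add' x y := by simp [mul_add, Finset.sum_add_distrib]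
  map_smul' a x := by
    simp only [Pi.smul_apply, smul_eq_mul, Finset.mul_sum, RingHom.id_apply]
    exact Finset.sum_congr rfl fun e _ => by ring

variable {N : Matroid α} {c : α → V}

theorem classSum_apply (x : α → ℝ) (v : V) : classSum c x v = sumOn x {e | c e = v} := rfl

theorem weightSum_apply (w x : α → ℝ) : weightSum w x = ∑ e, w e * x e := rfl

theorem classSum_single [DecidableEq α] [DecidableEq V] (e : α) :
    classSum c (Pi.single e 1) = Pi.single (c e) 1 := by
  ext v
  rw [classSum_apply, sumOn, Finset.sum_eq_single e]
  · simp [Set.indicator_apply, Pi.single_apply, eq_comm]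
  · intro f _ hf; simp [Set.indicator_apply, hf]
  · simp

theorem weightSum_single [DecidableEq α] (w : α → ℝ) (e : α) :
    weightSum w (Pi.single e 1) = w e := by
  simp [weightSum_apply, Pi.single_apply]

/-- The independence polytope of `N`, given by inequalities. -/
def indepPolyhedron (N : Matroid α) : Set (α → ℝ) :=
  {x | (∀ e, 0 ≤ x e) ∧ ∀ S, sumOn x S ≤ rank N S}

theorem convex_indepPolyhedron : Convex ℝ (indepPolyhedron N) := by
  rintro x ⟨hx0, hx1⟩ y ⟨hy0, hy1⟩ a b ha hb hab
  refine ⟨fun e => add_nonneg (mul_nonneg ha (hx0 e)) (mul_nonneg hb (hy0 e)), fun S => ?_⟩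
  rw [sumOn_add, sumOn_smul, sumOn_smul]
  calc a * sumOn x S + b * sumOn y S ≤ a * rank N S + b * rank N S := by
        gcongr
        · exact hx1 S
        · exact hy1 S
    _ = rank N S := by rw [← add_mul, hab, one_mul]

theorem incidence_mem_indepPolyhedron {I : Set α} (hI : N.Indep I) :
    incidence I ∈ indepPolyhedron N := by
  refine ⟨fun e => Set.indicator_nonneg (fun _ _ => zero_le_one) e, fun S => ?_⟩
  rw [sumOn_incidence]
  exact_mod_cast hI.ncard_inter_le_rank S

/-- `d` is a feasible direction of the independence polytope at the incidence vector of `F`. -/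
def IsFeasibleDirection (N : Matroid α) (F : Set α) (d : α → ℝ) : Prop :=
  ∃ t : ℝ, 0 < t ∧ incidence F + t • d ∈ indepPolyhedron N

/-- By convexity: weights inversely proportional to the step lengths `t` and `r` give both
directions the same coefficient. Exchanges can thus be combined fractionally even if performing them
all at once would destroy independence. -/
theorem IsFeasibleDirection.add {F : Set α} {d d' : α → ℝ} (h : IsFeasibleDirection N F d)
    (h' : IsFeasibleDirection N F d') : IsFeasibleDirection N F (d + d') := by
  obtain ⟨t, ht, h1⟩ := h
  obtain ⟨r, hr, h2⟩ := h'
  refine ⟨t * r / (t + r), by positivity, ?_⟩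
  convert convex_indepPolyhedron h1 h2 (a := r / (t + r)) (b := t / (t + r)) (by positivity)
    (by positivity) (by field_simp; ring) using 1
  ext e
  simp only [Pi.add_apply, Pi.smul_apply, smul_eq_mul]
  field_simp
  ring

theorem isFeasibleDirection_exchange [DecidableEq α] {F : Set α} {e f : α} (hf : f ∈ F)
    (he : e ∉ F) (h : N.Indep (insert e (F \ {f}))) :
    IsFeasibleDirection N F (Pi.single e 1 - Pi.single f 1) := by
  refine ⟨1, one_pos, ?_⟩
  convert incidence_mem_indepPolyhedron h using 1
  ext g
  have hne : e ≠ f := fun h => he (h ▸ hf)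
  by_cases hge : g = e
  · subst hge; simp [incidence, he, hne]
  · by_cases hgf : g = f
    · subst hgf; simp [incidence, hf, hge]
    · by_cases hg : g ∈ F <;> simp [incidence, hge, hgf, hg]

/-- Extend `insert e X` to a base inside `insert e F`; by cardinality it omits exactly one element
of `F`, which lies outside `X`. -/
theorem exists_exchange_of_notMem_closure (hE : N.E = univ) {F X : Set α} {e : α}
    (hF : N.IsBase F) (hX : X ⊆ F) (he : e ∉ N.closure X) (heF : e ∉ F) :
    ∃ f ∈ F \ X, N.Indep (insert e (F \ {f})) := by
  have heX : e ∉ X := fun h => heF (hX h)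
  have hind : N.Indep (insert e X) :=
    ((hF.indep.subset hX).notMem_closure_iff_of_notMem heX (by simp [hE])).1 he
  obtain ⟨B, hB, h1, h2⟩ := hind.exists_isBase_subset_union_isBase hF
  have h2' : B ⊆ insert e F := h2.trans (by
    rintro g ((rfl | hg) | hg)
    · exact mem_insert _ _
    · exact mem_insert_of_mem _ (hX hg)
    · exact mem_insert_of_mem _ hg)
  have hnot : ¬ F ⊆ B := fun h => heF <| by
    rw [hF.eq_of_subset_indep hB.indep h]; exact h1 (mem_insert _ _)
  obtain ⟨f, hfF, hfB⟩ := not_subset.1 hnot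
  have hcard := hB.ncard_eq_ncard_of_isBase hF
  have hsub : B ⊆ insert e (F \ {f}) := fun g hg => by
    rcases h2' hg with rfl | hgF
    · exact mem_insert _ _
    · exact mem_insert_of_mem _ ⟨hgF, fun h => hfB (h ▸ hg)⟩
  have heq : B = insert e (F \ {f}) := by
    refine Set.eq_of_subset_of_ncard_le hsub ?_ (Set.toFinite _)
    rw [ncard_insert_of_notMem (fun h => heF h.1) (Set.toFinite _),
      ncard_sdiff_singleton_add_one hfF (Set.toFinite _), hcard]
  exact ⟨f, ⟨hfF, fun h => hfB (h1 (mem_insert_of_mem _ h))⟩, heq ▸ hB.indep⟩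

end Directions

/-! ### A witness flat for each popular section. -/

section Witness

variable {α V : Type*} [Fintype α] [Fintype V] {N : Matroid α} {c : α → V}
  {pref : α → α → Prop} {s : V → α} {d : V → α}

theorem sum_eq_sum_section (hs : IsIndepSection N c s) (w : α → ℝ) :
    weightSum w (incidence (range s)) = ∑ v, w (s v) := by
  classical
  rw [weightSum_apply, ← Finset.sum_image (f := w) (g := s) (s := Finset.univ)
    (fun _ _ _ _ h => hs.injective h)]
  symm
  refine Finset.sum_subset_zero_on_sdiff (Finset.subset_univ _) ?_ ?_
  · intro e he
    have : e ∉ range s := by simpa using he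
    simp [incidence, this]
  · intro e he
    have : e ∈ range s := by simpa using he
    simp only [incidence, Set.indicator_of_mem this, Pi.one_apply, mul_one]

theorem classSum_section (hs : IsIndepSection N c s) (v : V) :
    sumOn (incidence (range s)) {e | c e = v} = 1 := by
  have : range s ∩ {e | c e = v} = {s v} := by
    ext e
    constructor
    · rintro ⟨⟨u, rfl⟩, hu⟩
      rw [mem_ofPred_eq, hs.class_eq] at hu
      rw [hu]; rfl
    · rintro rfl; exact ⟨mem_range_self v, hs.class_eq v⟩
  rw [sumOn_incidence, this, ncard_singleton, Nat.cast_one]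

/-- A popular section is optimal in its own voting weights over the fractional sections. -/
theorem IsPopularSection.weightSum_nonpos (hpref : IsWeakRanking c pref)
    (hcard : ∀ I, N.Indep I → I.ncard ≤ Fintype.card V)
    (hs : IsPopularSection N c pref s) {x : α → ℝ}
    (hx : IsFeasibleDirection N (range s) x) (hclass : classSum c x = 0) :
    weightSum (fun e => vote pref e (s (c e))) x ≤ 0 := by
  obtain ⟨r, hr, hx0, hx1⟩ := hx
  -- With no prescribed tight sets and no forbidden coordinates, this face is a hull of independent
  -- sections, on which the weights of `s` are nonpositive.
  have hmem : incidence (range s) + r • x ∈ tightFace N c ∅ univ := by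
    refine ⟨hx0, fun v => ?_, hx1, by simp, by simp⟩
    rw [sumOn_add, sumOn_smul, ← classSum_apply (c := c) x, hclass,
      classSum_section hs.toIsIndepSection]
    simp
  have hhull := tightFace_subset_convexHull hcard hmem
  set w : α → ℝ := fun e => vote pref e (s (c e)) with hw
  have hle : convexHull ℝ (incidence '' {F | ∃ s : V → α, (∀ v, c (s v) = v) ∧
      F = range s ∧ N.Indep F ∧ (∀ C ∈ (∅ : Set (Set α)), (F ∩ C).ncard = rank N C) ∧
        F ⊆ univ}) ⊆ {y | weightSum w y ≤ 0} := by
    refine convexHull_min ?_ (convex_halfSpace_le (weightSum w).isLinear 0)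
    rintro _ ⟨_, ⟨t, ht, rfl, hind, -, -⟩, rfl⟩
    have ht' : IsIndepSection N c t := ⟨ht, hind⟩
    rw [mem_ofPred_eq, sum_eq_sum_section ht']
    simpa [hw, ht] using hs.sum_vote_le t ht'
  have h1 : weightSum w (incidence (range s) + r • x) ≤ 0 := hle hhull
  have h2 : weightSum w (incidence (range s)) = 0 := by
    rw [sum_eq_sum_section hs.toIsIndepSection]
    refine Finset.sum_eq_zero fun v _ => ?_
    rw [hw]
    simp only [hs.class_eq]
    exact hpref.vote_self _
  rw [map_add, map_smul, h2, zero_add, smul_eq_mul] at h1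
  nlinarith

/-- An element `f` of `F = range s` is reachable if some feasible direction at `F` takes one unit
away from the class of `f`, gives it to some class, and gains a vote. -/
def IsReachable [DecidableEq V] (N : Matroid α) (c : α → V) (pref : α → α → Prop) (s : V → α)
    (f : α) : Prop :=
  ∃ v₀ : V, ∃ x : α → ℝ, IsFeasibleDirection N (range s) x ∧
    classSum c x = Pi.single v₀ 1 - Pi.single (c f) 1 ∧
    1 ≤ weightSum (fun e => vote pref e (s (c e))) x

/-- A certificate of popularity for one section: a flat that is spanned by `s` and bounds the votes
against `s`. -/
structure IsWitness (N : Matroid α) (c : α → V) (pref : α → α → Prop) (s : V → α) (C : Set α) :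
    Prop where
  closure_eq : N.closure (range s ∩ C) = C
  mem_of_pref : ∀ e, pref e (s (c e)) → e ∈ C
  notMem_of_pref : ∀ e, e ∉ N.loops → pref e (s (c e)) → s (c e) ∉ C
  mem_of_tie : ∀ e, ¬ pref e (s (c e)) ∧ ¬ pref (s (c e)) e → s (c e) ∈ C → e ∈ C

section Reach

variable [DecidableEq V]

theorem isReachable_of_pref [DecidableEq α] (hpref : IsWeakRanking c pref)
    (hs : IsIndepSection N c s) {e f : α} (he : pref e (s (c e))) (hf : f ∈ range s)
    (hex : N.Indep (insert e (range s \ {f}))) : IsReachable N c pref s f := by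
  have heF : e ∉ range s := fun h => by
    rw [hs.mem_range_iff.1 h] at he; exact hpref.irrefl e he
  refine ⟨c e, _, isFeasibleDirection_exchange hf heF hex, ?_, ?_⟩
  · rw [map_sub, classSum_single, classSum_single]
  · rw [map_sub, weightSum_single, weightSum_single, hs.mem_range_iff.1 hf, hpref.vote_self,
      vote_of_pref he, sub_zero]

/-- The class of `e`, which had lost a unit, regains it through `e` without changing the votes, and
the deficit passes to the class of `f`. -/
theorem IsReachable.step [DecidableEq α] (hpref : IsWeakRanking c pref)
    (hs : IsIndepSection N c s) {e f : α} (h : IsReachable N c pref s (s (c e)))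
    (he : ¬ pref e (s (c e)) ∧ ¬ pref (s (c e)) e) (heF : e ∉ range s) (hf : f ∈ range s)
    (hex : N.Indep (insert e (range s \ {f}))) : IsReachable N c pref s f := by
  obtain ⟨v₀, x, hx, hclass, hw⟩ := h
  refine ⟨v₀, _, hx.add (isFeasibleDirection_exchange hf heF hex), ?_, ?_⟩
  · rw [map_add, map_sub, classSum_single, classSum_single, hclass, hs.class_eq]
    abel
  · rw [map_add, map_sub, weightSum_single, weightSum_single, hs.mem_range_iff.1 hf,
      hpref.vote_self, vote_of_tie he, sub_zero, add_zero]
    exact hw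

/-- Filling the deficit of `c e` with `e` gains a second vote, and only the surplus in `v₀` remains.
The nonloop `e` can displace some `s u`. If `s u` is a dummy, `e` can displace `s v₀` instead, for a
net gain of at least 2. Otherwise the dummy of `u` displaces `s v₀` and refills the class of `u`,
losing at most one vote. Both cases contradict optimality. -/
theorem IsPopularSection.not_isReachable_of_pref (hpref : IsWeakRanking c pref)
    (hpad : IsPadding N c d) (hs : IsPopularSection N c pref s) {e : α} (hloop : e ∉ N.loops)
    (he : pref e (s (c e))) : ¬ IsReachable N c pref s (s (c e)) := by
  classical
  rintro ⟨v₀, x, hx, hclass, hw⟩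
  have hs' := hs.toIsIndepSection
  have hrange : ∀ u, vote pref (s u) (s (c (s u))) = 0 := fun u => by
    rw [hs.class_eq]; exact hpref.vote_self _
  have heF : e ∉ range s := fun h => by
    rw [hs'.mem_range_iff.1 h] at he; exact hpref.irrefl e he
  obtain ⟨_, ⟨⟨u, rfl⟩, -⟩, hex⟩ := exists_exchange_of_notMem_closure hpad.ground_eq
    (hs'.isBase hpad.ncard_le) (empty_subset _) hloop heF
  by_cases hu : s u = d u
  · have hex' := hpad.exchange' s hs.class_eq hs.indep u hu e heF hex v₀
    have := hs.weightSum_nonpos hpref hpad.ncard_le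
      (hx.add (isFeasibleDirection_exchange (mem_range_self v₀) heF hex')) (by
        rw [map_add, map_sub, classSum_single, classSum_single, hclass, hs.class_eq, hs.class_eq]
        abel)
    rw [map_add, map_sub, weightSum_single, weightSum_single, hrange, vote_of_pref he] at this
    linarith
  · have hdF : d u ∉ range s := fun h => hu <| by
      have := hs'.mem_range_iff.1 h
      rwa [hpad.class_eq] at this
    have hex' := hpad.exchange s hs.class_eq hs.indep v₀ u hu
    have := hs.weightSum_nonpos hpref hpad.ncard_le
      ((hx.add (isFeasibleDirection_exchange (mem_range_self u) heF hex)).add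
        (isFeasibleDirection_exchange (mem_range_self v₀) hdF hex')) (by
        rw [map_add, map_add, map_sub, map_sub, classSum_single, classSum_single, classSum_single,
          classSum_single, hclass, hs.class_eq, hs.class_eq, hs.class_eq, hpad.class_eq]
        abel)
    rw [map_add, map_add, map_sub, map_sub, weightSum_single, weightSum_single, weightSum_single,
      weightSum_single, hrange, hrange, vote_of_pref he] at this
    have h1 := neg_one_le_vote (pref := pref) (d u) (s (c (d u)))
    linarith

end Reach

/-- The witness is the closure of the reachable elements. A preferred element, or one tied with a
reachable choice, cannot lie outside it: it could be exchanged for an unreachable element, making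
that element reachable. -/
theorem IsPopularSection.exists_isWitness (hpref : IsWeakRanking c pref)
    (hpad : IsPadding N c d) (hs : IsPopularSection N c pref s) :
    ∃ C, IsWitness N c pref s C := by
  classical
  have hs' := hs.toIsIndepSection
  have hB := hs'.isBase hpad.ncard_le
  set X := {f | f ∈ range s ∧ IsReachable N c pref s f} with hX
  have hXF : X ⊆ range s := fun f hf => hf.1
  have hFX : range s ∩ N.closure X = X := by
    rw [inter_comm]; exact hs.indep.closure_inter_eq_self_of_subset hXF
  refine ⟨N.closure X, by rw [hFX], fun e he => ?_, fun e hl he hmem => ?_, fun e he hmem => ?_⟩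
  · by_contra hC
    have heF : e ∉ range s := fun h => by
      rw [hs'.mem_range_iff.1 h] at he; exact hpref.irrefl e he
    obtain ⟨f, hf, hex⟩ := exists_exchange_of_notMem_closure hpad.ground_eq hB hXF hC heF
    exact hf.2 ⟨hf.1, isReachable_of_pref hpref hs' he hf.1 hex⟩
  · have : s (c e) ∈ X := hFX ▸ ⟨mem_range_self _, hmem⟩
    exact hs.not_isReachable_of_pref hpref hpad hl he this.2
  · have hsX : s (c e) ∈ X := hFX ▸ ⟨mem_range_self _, hmem⟩
    by_cases heF : e ∈ range s
    · rwa [hs'.mem_range_iff.1 heF] at hmem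
    by_contra hC
    obtain ⟨f, hf, hex⟩ := exists_exchange_of_notMem_closure hpad.ground_eq hB hXF hC heF
    exact hf.2 ⟨hf.1, hsX.2.step hpref hs' he heF hf.1 hex⟩

end Witness

/-! ### Complementary slackness and the common flat of all witnesses. -/

section CommonWitness

variable {α V : Type*} [Fintype α] [Fintype V] {N : Matroid α} {c : α → V}
  {pref : α → α → Prop} {s t : V → α} {d : V → α} {C : Set α}

theorem IsIndepSection.notMem_loops (hs : IsIndepSection N c s) (v : V) : s v ∉ N.loops :=
  fun h => hs.indep.disjoint_loops.le_bot ⟨mem_range_self v, h⟩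

open Classical in
-- Dual feasibility. Summed over a section `t`, the right side is |t ∩ C| - |s ∩ C|, which is at
-- most 0 because `s` spans `C`.
theorem IsWitness.vote_le (hpref : IsWeakRanking c pref) (hC : IsWitness N c pref s C) {e : α}
    (he : e ∉ N.loops) (hse : c (s (c e)) = c e) : vote pref e (s (c e)) ≤
      (if e ∈ C then 1 else 0) - (if s (c e) ∈ C then 1 else 0) := by
  by_cases h1 : pref e (s (c e))
  · rw [vote_of_pref h1, if_pos (hC.mem_of_pref e h1), if_neg (hC.notMem_of_pref e he h1), sub_zero]
  · by_cases h2 : pref (s (c e)) e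
    · rw [hpref.vote_of_pref' hse.symm h2]
      split_ifs <;> norm_num
    · rw [vote_of_tie ⟨h1, h2⟩]
      by_cases h3 : s (c e) ∈ C
      · rw [if_pos h3, if_pos (hC.mem_of_tie e ⟨h1, h2⟩ h3), sub_self]
      · rw [if_neg h3, sub_zero]
        split_ifs <;> norm_num

theorem IsPopularSection.sum_vote_eq_zero (hpref : IsWeakRanking c pref)
    (hs : IsPopularSection N c pref s) (ht : IsPopularSection N c pref t) :
    ∑ v, vote pref (t v) (s v) = 0 := by
  refine le_antisymm (hs.sum_vote_le t ht.toIsIndepSection) ?_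
  have h := ht.sum_vote_le s hs.toIsIndepSection
  rw [Finset.sum_congr rfl fun v _ =>
    hpref.vote_swap (show c (t v) = c (s v) by rw [ht.class_eq, hs.class_eq]),
    Finset.sum_neg_distrib] at h
  linarith

open Classical in
/-- Complementary slackness between a witness of one popular section and another one. -/
theorem IsWitness.slackness (hpref : IsWeakRanking c pref) (hC : IsWitness N c pref s C)
    (hs : IsPopularSection N c pref s) (ht : IsPopularSection N c pref t) :
    rank N C ≤ (range t ∩ C).ncard ∧ ∀ v, vote pref (t v) (s v) =
      (if t v ∈ C then 1 else 0) - (if s v ∈ C then 1 else 0) := by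
  have hle : ∀ v ∈ Finset.univ, vote pref (t v) (s v) ≤
      (if t v ∈ C then 1 else 0) - (if s v ∈ C then 1 else 0) := fun v _ => by
    have := hC.vote_le hpref (ht.notMem_loops v) (by rw [ht.class_eq, hs.class_eq])
    rwa [ht.class_eq] at this
  have hsum := Finset.sum_le_sum hle
  have hrank : rank N C = (range s ∩ C).ncard := by
    rw [← (hs.indep.subset inter_subset_left).rank_eq_ncard, ← rank_closure N (range s ∩ C),
      hC.closure_eq]
  have htC : ((range t ∩ C).ncard : ℝ) ≤ rank N C := by
    exact_mod_cast ht.indep.ncard_inter_le_rank C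
  have htot := hsum
  rw [hs.sum_vote_eq_zero hpref ht, Finset.sum_sub_distrib, ht.sum_ite_mem, hs.sum_ite_mem,
    ← hrank] at htot
  have heq : ((range t ∩ C).ncard : ℝ) = rank N C := by linarith
  refine ⟨by exact_mod_cast heq.ge, fun v => ?_⟩
  refine (Finset.sum_eq_sum_iff_of_le hle).1 ?_ v (Finset.mem_univ v)
  rw [hs.sum_vote_eq_zero hpref ht, Finset.sum_sub_distrib, ht.sum_ite_mem, hs.sum_ite_mem,
    ← hrank, heq, sub_self]

/-- If the element that a popular section chooses for `v` lies in a witness, then it is a top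
choice of `v`, and the witness contains all top choices. -/
theorem IsWitness.top_of_mem (hpref : IsWeakRanking c pref) (hpad : IsPadding N c d)
    (hC : IsWitness N c pref s C) (hs : IsPopularSection N c pref s)
    (ht : IsPopularSection N c pref t) {v : V} (hv : t v ∈ C) {e : α} (hev : c e = v)
    (he : e ∉ N.loops) : ¬ pref e (t v) ∧ (¬ pref (t v) e → e ∈ C) := by
  classical
  have hvote := (hC.slackness hpref hs ht).2 v
  rw [if_pos hv] at hvote
  have hts : c (t v) = c (s v) := by rw [ht.class_eq, hs.class_eq]
  have het : c e = c (t v) := by rw [ht.class_eq, hev]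
  subst hev
  by_cases hsv : s (c e) ∈ C
  · rw [if_pos hsv, sub_self] at hvote
    have htie : ¬ pref (t (c e)) (s (c e)) ∧ ¬ pref (s (c e)) (t (c e)) := by
      refine ⟨fun h => ?_, fun h => ?_⟩
      · rw [vote_of_pref h] at hvote; norm_num at hvote
      · rw [hpref.vote_of_pref' hts h] at hvote; norm_num at hvote
    have htop : ¬ pref e (t (c e)) := fun h =>
      hC.notMem_of_pref e he (hpref.of_pref_of_incomp het hts h htie) hsv
    exact ⟨htop, fun h => hC.mem_of_tie e (hpref.incomp_trans het hts ⟨htop, h⟩ htie) hsv⟩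
  · rw [if_neg hsv, sub_zero] at hvote
    have hpr : pref (t (c e)) (s (c e)) := by
      by_contra h
      have := vote_nonpos_of_not_pref h
      linarith
    -- Here `t` beats `s` at this agent. If `e` beat `t`, a witness `D` of `t` would not contain the
    -- choice of `t`, and slackness for `D` would make the vote of `s` against `t` nonnegative.
    have htop : ¬ pref e (t (c e)) := fun h => by
      obtain ⟨D, hD⟩ := ht.exists_isWitness hpref hpad
      have hnot := hD.notMem_of_pref e he h
      have hvote' := (hD.slackness hpref ht hs).2 (c e)
      rw [if_neg hnot, sub_zero, hpref.vote_of_pref' hts.symm hpr] at hvote'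
      split_ifs at hvote' <;> norm_num at hvote'
    exact ⟨htop, fun h => hC.mem_of_pref e (hpref.of_incomp_of_pref het hts ⟨htop, h⟩ hpr)⟩

/-- The flat spanned by all witnesses of popular sections. -/
def witnessSpan (N : Matroid α) (c : α → V) (pref : α → α → Prop) : Set α :=
  N.closure (⋃₀ {C | ∃ s, IsPopularSection N c pref s ∧ IsWitness N c pref s C})

theorem IsWitness.subset_witnessSpan (hE : N.E = univ) (hs : IsPopularSection N c pref s)
    (hC : IsWitness N c pref s C) : C ⊆ witnessSpan N c pref := by
  refine (subset_sUnion_of_mem ?_).trans (N.subset_closure _ (by simp [hE]))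
  exact ⟨s, hs, hC⟩

theorem IsPopularSection.sUnion_subset_closure (hpref : IsWeakRanking c pref)
    (hE : N.E = univ) (ht : IsPopularSection N c pref t) :
    ⋃₀ {C | ∃ s, IsPopularSection N c pref s ∧ IsWitness N c pref s C} ⊆ N.closure (range t ∩
      ⋃₀ {C | ∃ s, IsPopularSection N c pref s ∧ IsWitness N c pref s C}) := by
  rintro e ⟨C, ⟨s, hs, hC⟩, he⟩
  refine N.closure_subset_closure (inter_subset_inter_right _ (subset_sUnion_of_mem ?_))
    (subset_closure_inter_of_rank_le hE ht.indep (hC.slackness hpref hs ht).1 he)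
  exact ⟨s, hs, hC⟩

/-- Closure adds no elements of `range t`: the flat is spanned by the part of `range t` in the union
of witnesses, and `range t` is independent. -/
theorem IsPopularSection.exists_mem_of_mem_witnessSpan (hpref : IsWeakRanking c pref)
    (hE : N.E = univ) (ht : IsPopularSection N c pref t) {v : V}
    (hv : t v ∈ witnessSpan N c pref) :
    ∃ C s, IsPopularSection N c pref s ∧ IsWitness N c pref s C ∧ t v ∈ C := by
  have h := N.closure_subset_closure_of_subset_closure (ht.sUnion_subset_closure hpref hE) hv
  obtain ⟨-, C, ⟨s, hs, hC⟩, hmem⟩ :=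
    (ht.indep.closure_inter_eq_self_of_subset inter_subset_left).subset ⟨h, mem_range_self v⟩
  exact ⟨C, s, hs, hC, hmem⟩

theorem IsPopularSection.closure_inter_witnessSpan (hpref : IsWeakRanking c pref)
    (hE : N.E = univ) (ht : IsPopularSection N c pref t) :
    N.closure (range t ∩ witnessSpan N c pref) = witnessSpan N c pref := by
  refine (N.closure_subset_closure inter_subset_right).trans
    (by rw [witnessSpan, N.closure_closure]) |>.antisymm ?_
  refine (N.closure_subset_closure_of_subset_closure (ht.sUnion_subset_closure hpref hE)).trans ?_
  exact N.closure_subset_closure (inter_subset_inter_right _ (N.subset_closure _ (by simp [hE])))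

theorem IsPopularSection.not_pref_of_notMem_witnessSpan (hpref : IsWeakRanking c pref)
    (hpad : IsPadding N c d) (ht : IsPopularSection N c pref t) {e : α}
    (he : e ∉ witnessSpan N c pref) : ¬ pref e (t (c e)) := fun h => by
  obtain ⟨D, hD⟩ := ht.exists_isWitness hpref hpad
  exact he (hD.subset_witnessSpan hpad.ground_eq ht (hD.mem_of_pref e h))

theorem IsPopularSection.top_of_mem_witnessSpan (hpref : IsWeakRanking c pref)
    (hpad : IsPadding N c d) (ht : IsPopularSection N c pref t) {v : V}
    (hv : t v ∈ witnessSpan N c pref) {e : α} (hev : c e = v) (he : e ∉ N.loops) :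
    ¬ pref e (t v) ∧ (¬ pref (t v) e → e ∈ witnessSpan N c pref) := by
  obtain ⟨C, s, hs, hC, hmem⟩ := ht.exists_mem_of_mem_witnessSpan hpref hpad.ground_eq hv
  have h := hC.top_of_mem hpref hpad hs ht hmem hev he
  exact ⟨h.1, fun h' => hC.subset_witnessSpan hpad.ground_eq hs (h.2 h')⟩

end CommonWitness

/-! ### Levels in the chain of loops, flat and ground set. -/

section Levels

variable {α V : Type*} [Finite α] {N : Matroid α} {c : α → V} {pref : α → α → Prop}
  {𝒞 : Set (Set α)} {C : Set α}

theorem lev_le_levStar (e : α) : lev 𝒞 e ≤ levStar c 𝒞 (c e) :=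
  le_csSup (Set.toFinite _).bddAbove ⟨e, rfl, rfl⟩

theorem levStar_eq {e : α} {v : V} (he : c e = v) (h : ∀ f, c f = v → lev 𝒞 f ≤ lev 𝒞 e) :
    levStar c 𝒞 v = lev 𝒞 e :=
  IsGreatest.csSup_eq ⟨⟨e, he, rfl⟩, by rintro _ ⟨f, hf, rfl⟩; exact h f hf⟩

/-- The chain that consists of the loops, the set `C`, and the ground set. -/
def flatChain (N : Matroid α) (C : Set α) : Set (Set α) := {N.loops, C, univ} \ {∅}

theorem isFullChain_flatChain [Nonempty α] (hC : N.closure C = C) :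
    IsFullChain (flatChain N C) := by
  have hl : N.loops ⊆ C := by
    rw [← hC, ← N.closure_empty]; exact N.closure_subset_closure (empty_subset _)
  refine ⟨?_, fun h => h.2 rfl, ⟨by simp, ?_⟩⟩
  · rintro A ⟨hA, -⟩ B ⟨hB, -⟩ -
    simp only [mem_insert_iff, mem_singleton_iff] at hA hB
    rcases hA with rfl | rfl | rfl <;> rcases hB with rfl | rfl | rfl <;> simp [hl]
  · exact univ_nonempty.ne_empty

theorem ncard_flatChain_diff_le : (flatChain N C \ {N.loops}).ncard ≤ 2 := by
  refine (ncard_le_ncard (t := {C, univ}) ?_ (Set.toFinite _)).trans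
    ((ncard_insert_le _ _).trans (by simp))
  rintro A ⟨⟨hA, -⟩, hA'⟩
  exact hA.resolve_left hA'

/-- Levels are only compared, never computed, because members of the chain may coincide or be
discarded as empty. -/
theorem lev_flatChain_eq {e f : α} (he : e ∉ N.loops) (hf : f ∉ N.loops) (h : e ∈ C ↔ f ∈ C) :
    lev (flatChain N C) e = lev (flatChain N C) f := by
  rw [lev, lev]
  congr 2
  ext A
  refine and_congr_right ?_
  rintro ⟨hA, -⟩
  simp only [mem_insert_iff, mem_singleton_iff] at hA
  rcases hA with rfl | rfl | rfl
  · simp [he, hf]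
  · rw [h]
  · simp

theorem lev_flatChain_succ {e f : α} (he : e ∉ N.loops) (hf : f ∉ N.loops) (heC : e ∈ C)
    (hfC : f ∉ C) : lev (flatChain N C) f = lev (flatChain N C) e + 1 := by
  have hnot : C ∉ {A ∈ flatChain N C | e ∉ A} := fun h => h.2 heC
  rw [lev, lev, ← ncard_insert_of_notMem hnot (Set.toFinite _)]
  congr 2
  ext A
  simp only [mem_insert_iff, mem_ofPred_eq]
  constructor
  · rintro ⟨hA, hfA⟩
    have hA' := hA.1
    simp only [mem_insert_iff, mem_singleton_iff] at hA'
    rcases hA' with rfl | rfl | rfl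
    · exact Or.inr ⟨hA, he⟩
    · exact Or.inl rfl
    · simp at hfA
  · rintro (rfl | ⟨hA, heA⟩)
    · exact ⟨⟨by simp, fun h => by rw [mem_singleton_iff.1 h] at heC; exact heC⟩, hfC⟩
    · refine ⟨hA, ?_⟩
      have hA' := hA.1
      simp only [mem_insert_iff, mem_singleton_iff] at hA'
      rcases hA' with rfl | rfl | rfl
      · exact hf
      · exact absurd heC heA
      · simp at heA

/-- The reason for the bottom member of the chain: an agent may prefer a loop to everything else, so
loops must not compete on the level of a chosen element. -/
theorem lev_flatChain_lt (hC : N.closure C = C) {e f : α} (he : e ∈ N.loops) (hf : f ∉ N.loops) :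
    lev (flatChain N C) e < lev (flatChain N C) f := by
  have hl : N.loops ⊆ C := by
    rw [← hC, ← N.closure_empty]; exact N.closure_subset_closure (empty_subset _)
  have h0 : {A ∈ flatChain N C | e ∉ A} = ∅ := by
    refine eq_empty_of_forall_notMem ?_
    rintro A ⟨⟨hA, -⟩, heA⟩
    simp only [mem_insert_iff, mem_singleton_iff] at hA
    rcases hA with rfl | rfl | rfl
    · exact heA he
    · exact heA (hl he)
    · simp at heA
  rw [lev, lev, h0, ncard_empty]
  have : 0 < {A ∈ flatChain N C | f ∉ A}.ncard := by
    rw [ncard_pos (Set.toFinite _)]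
    exact ⟨N.loops, ⟨by simp, fun h => by rw [mem_singleton_iff.1 h] at he; exact he⟩, hf⟩
  omega

end Levels

/-! ### Dual certificates and popularity. -/

section Certificate

variable {α V : Type*} [Fintype α] [Fintype V] {N : Matroid α} {c : α → V}
  {pref : α → α → Prop} {s t : V → α} {d : V → α} {𝒞 : Set (Set α)}

theorem IsPopularSection.range_subset_certElements (hpref : IsWeakRanking c pref)
    (hpad : IsPadding N c d) (ht : IsPopularSection N c pref t) :
    range t ⊆ certElements c pref (flatChain N (witnessSpan N c pref)) := by
  set C := witnessSpan N c pref with hCdef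
  have hC : N.closure C = C := N.closure_closure _
  rintro _ ⟨v, rfl⟩
  have htv := ht.notMem_loops v
  have hcv := ht.class_eq v
  have hloop : ∀ f, lev (flatChain N C) (t v) ≤ lev (flatChain N C) f → f ∉ N.loops :=
    fun f hf hl => absurd (lev_flatChain_lt hC hl htv) (not_lt.2 hf)
  simp only [certElements, mem_ofPred_eq, hcv]
  by_cases hv : t v ∈ C
  · have htop := fun (e : α) (h : c e = v) (he : e ∉ N.loops) =>
      ht.top_of_mem_witnessSpan hpref hpad hv h he
    -- If the whole class lies in the flat, the choice has the top level. Otherwise it is exactly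
    -- one level below, and it must strictly beat the elements outside the flat; this holds because
    -- a nonloop that it does not strictly beat lies in the flat.
    by_cases hall : ∀ f, c f = v → f ∈ C
    · have hstar : levStar c (flatChain N C) v = lev (flatChain N C) (t v) :=
        levStar_eq hcv fun f hf => by
          by_cases hl : f ∈ N.loops
          · exact (lev_flatChain_lt hC hl htv).le
          · exact (lev_flatChain_eq hl htv (by simp [hv, hall f hf])).le
      refine Or.inl ⟨hstar.symm, ?_⟩
      rintro ⟨e, hev, hlev, hp⟩
      exact (htop e hev (hloop e (by rw [hlev, hstar]))).1 hp
    · push Not at hall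
      obtain ⟨g, hgv, hg⟩ := hall
      have hgl : g ∉ N.loops := fun h => hg <| by
        rw [← hC]; exact N.closure_subset_closure (empty_subset _) h
      have hsucc := lev_flatChain_succ htv hgl hv hg
      have hstar : levStar c (flatChain N C) v = lev (flatChain N C) (t v) + 1 := by
        rw [← hsucc]
        refine levStar_eq hgv fun f hf => ?_
        by_cases hl : f ∈ N.loops
        · exact (lev_flatChain_lt hC hl hgl).le
        · by_cases hfC : f ∈ C
          · rw [hsucc, lev_flatChain_eq hl htv (by simp [hv, hfC])]; omega
          · exact (lev_flatChain_eq hl hgl (by simp [hg, hfC])).le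
      refine Or.inr ⟨hstar.symm, ?_, fun f hf hlev => ?_⟩
      · rintro ⟨e, hev, hlev, hp⟩
        exact (htop e hev (hloop e (by omega))).1 hp
      · by_contra hp
        have hfl := hloop f (by omega)
        have hfC := (htop f hf hfl).2 hp
        have := lev_flatChain_eq (C := C) hfl htv (iff_of_true hfC hv)
        omega
  · have hstar : levStar c (flatChain N C) v = lev (flatChain N C) (t v) :=
      levStar_eq hcv fun f hf => by
        by_cases hl : f ∈ N.loops
        · exact (lev_flatChain_lt hC hl htv).le
        · by_cases hfC : f ∈ C
          · rw [lev_flatChain_succ hl htv hfC hv]; omega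
          · exact (lev_flatChain_eq hl htv (by simp [hv, hfC])).le
    refine Or.inl ⟨hstar.symm, ?_⟩
    rintro ⟨e, hev, hlev, hp⟩
    have hel := hloop e (by rw [hlev, hstar])
    have heC : e ∉ C := fun h => by
      have := lev_flatChain_succ hel htv h hv
      omega
    have := ht.not_pref_of_notMem_witnessSpan hpref hpad heC
    rw [hev] at this
    exact this hp

/-- One chain is a dual certificate for all popular sections. -/
theorem IsPopularSection.isDualCertificate [Nonempty V] (hpref : IsWeakRanking c pref)
    (hpad : IsPadding N c d) (ht : IsPopularSection N c pref t) :
    IsDualCertificate N c pref (flatChain N (witnessSpan N c pref)) (range t) := by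
  have : Nonempty α := ⟨t (Classical.arbitrary V)⟩
  refine ⟨isFullChain_flatChain (N.closure_closure _),
    ht.range_subset_certElements hpref hpad, ?_⟩
  rintro A ⟨hA, -⟩
  simp only [mem_insert_iff, mem_singleton_iff] at hA
  rcases hA with rfl | rfl | rfl
  · rw [disjoint_iff_inter_eq_empty.1 ht.indep.disjoint_loops, N.closure_empty]
  · exact ht.closure_inter_witnessSpan hpref hpad.ground_eq
  · rw [inter_univ, (ht.toIsIndepSection.isBase hpad.ncard_le).closure_eq, hpad.ground_eq]

/-- Dual feasibility for an arbitrary chain. A drop of at least one level pays for any vote, so only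
`e` on the level of `f` or above it matters; these are the cases that the definition of
`certElements` controls. -/
theorem vote_add_lev_le (hpref : IsWeakRanking c pref) {e f : α} (hf : f ∈ certElements c pref 𝒞)
    (hef : c e = c f) : vote pref e f + lev 𝒞 e ≤ lev 𝒞 f := by
  have hle : lev 𝒞 e ≤ levStar c 𝒞 (c f) := hef ▸ lev_le_levStar e
  have hone := vote_le_one (pref := pref) e f
  rcases hf with ⟨h1, h2⟩ | ⟨h1, h2, h3⟩
  · rcases hle.eq_or_lt with h | h
    · have := vote_nonpos_of_not_pref fun hp => h2 ⟨e, hef, h, hp⟩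
      rw [h1, h]; linarith
    · have : (lev 𝒞 e : ℝ) + 1 ≤ lev 𝒞 f := by rw [h1]; exact_mod_cast h
      linarith
  · rcases hle.eq_or_lt with h | h
    · rw [hpref.vote_of_pref' hef (h3 e hef h), h, ← h1]; push_cast; linarith
    · rcases (Nat.succ_le_of_lt h).eq_or_lt with h' | h'
      · have := vote_nonpos_of_not_pref fun hp => h2 ⟨e, hef, h', hp⟩
        have h4 : lev 𝒞 e = lev 𝒞 f := by omega
        rw [h4]; linarith
      · have h4 : lev 𝒞 e + 1 ≤ lev 𝒞 f := by omega
        have : (lev 𝒞 e : ℝ) + 1 ≤ lev 𝒞 f := by exact_mod_cast h4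
        linarith

open Classical in
-- Double counting of the pairs of an agent and a chain member that misses its choice. Tightness on
-- the chain thus minimizes the total level.
theorem IsIndepSection.sum_lev (hs : IsIndepSection N c s) :
    ∑ v, (lev 𝒞 (s v) : ℝ) = Fintype.card V + ∑ C ∈ 𝒞.toFinset,
      ((Fintype.card V : ℝ) - (range s ∩ C).ncard) := by
  have h1 : ∀ v, (lev 𝒞 (s v) : ℝ) = 1 + ∑ C ∈ 𝒞.toFinset,
      (1 - (if s v ∈ C then (1 : ℝ) else 0)) := fun v => by
    rw [lev, ncard_eq_toFinset_card']
    push_cast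
    rw [add_comm]
    congr 1
    rw [Finset.card_eq_sum_ones, Nat.cast_sum, show {C | C ∈ 𝒞 ∧ s v ∉ C}.toFinset =
      𝒞.toFinset.filter fun C => s v ∉ C by ext; simp, Finset.sum_filter]
    exact Finset.sum_congr rfl fun C _ => by split_ifs <;> simp_all
  simp only [h1, Finset.sum_add_distrib]
  rw [Finset.sum_comm]
  simp [Finset.sum_sub_distrib, ← hs.sum_ite_mem]

/-- Sections with a dual certificate are popular. -/
theorem IsIndepSection.isPopularSection (hpref : IsWeakRanking c pref)
    (hs : IsIndepSection N c s) (hsub : range s ⊆ certElements c pref 𝒞)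
    (htight : ∀ C ∈ 𝒞, (range s ∩ C).ncard = rank N C) : IsPopularSection N c pref s := by
  classical
  refine ⟨hs, fun t ht => ?_⟩
  have h1 : ∑ v, vote pref (t v) (s v) ≤ ∑ v, ((lev 𝒞 (s v) : ℝ) - lev 𝒞 (t v)) :=
    Finset.sum_le_sum fun v _ => by
      have := vote_add_lev_le (e := t v) hpref (hsub (mem_range_self v))
        (by rw [ht.class_eq, hs.class_eq])
      linarith
  refine h1.trans ?_
  rw [Finset.sum_sub_distrib, sub_nonpos, hs.sum_lev, ht.sum_lev]
  refine add_le_add_right (Finset.sum_le_sum fun C hC => sub_le_sub_left ?_ _) _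
  rw [htight C (by simpa using hC), Nat.cast_le]
  exact ht.indep.ncard_inter_le_rank C

end Certificate

/-! ### Common bases as sections. -/

section CommonBases

variable {α V : Type*} [Fintype α] [Fintype V] {N : Matroid α} {c : α → V}
  {pref : α → α → Prop} {s t : V → α} {d : V → α} {F : Set α}

/-- Since `d v` lies in the class of `v`, no class is empty, so a base of the partition matroid
meets every class. -/
theorem commonBase_iff (hcard : ∀ I, N.Indep I → I.ncard ≤ Fintype.card V)
    (hd : ∀ v, c (d v) = v) : CommonBase (partitionMatroid c) N F ↔
      ∃ s, IsIndepSection N c s ∧ F = range s := by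
  constructor
  · rintro ⟨hP, hN⟩
    have hFP := (partitionMatroid_indep_iff c F).1 hP.indep
    have hex : ∀ v, ∃ e ∈ F, c e = v := fun v => by
      by_contra hno
      push Not at hno
      have hins : (partitionMatroid c).Indep (insert (d v) F) := by
        rw [partitionMatroid_indep_iff]
        rintro e (rfl | he) f (rfl | hf) hef
        · rfl
        · exact absurd (hef ▸ hd v) (hno f hf)
        · exact absurd (hef.trans (hd v)) (hno e he)
        · exact hFP e he f hf hef
      have := hP.eq_of_subset_indep hins (subset_insert _ _)
      exact hno (d v) (this ▸ mem_insert _ _) (hd v)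
    choose s hsF hs using hex
    have hF : F = range s := by
      ext e
      constructor
      · intro he; exact ⟨c e, hFP _ (hsF _) e he (hs _)⟩
      · rintro ⟨v, rfl⟩; exact hsF v
    exact ⟨s, ⟨hs, hF ▸ hN.indep⟩, hF⟩
  · rintro ⟨s, hs, rfl⟩
    refine ⟨?_, hs.isBase hcard⟩
    rw [Matroid.isBase_iff_maximal_indep, maximal_subset_iff]
    refine ⟨?_, fun J hJ h => h.antisymm fun e he => ?_⟩
    · rw [partitionMatroid_indep_iff]
      rintro _ ⟨u, rfl⟩ _ ⟨v, rfl⟩ h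
      rw [hs.class_eq, hs.class_eq] at h
      rw [h]
    · rw [partitionMatroid_indep_iff] at hJ
      exact ⟨c e, hJ _ (h (mem_range_self _)) e he (hs.class_eq _)⟩

theorem agentPrefers_range_iff (hs : ∀ v, c (s v) = v) (ht : ∀ v, c (t v) = v) (v : V) :
    AgentPrefers c pref v (range s) (range t) ↔ pref (s v) (t v) := by
  constructor
  · rintro (⟨-, h⟩ | ⟨_, ⟨u, rfl⟩, _, ⟨w, rfl⟩, h1, h2, h3⟩)
    · exact absurd ⟨t v, mem_range_self v, ht v⟩ h
    · rw [hs] at h1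
      rw [ht] at h2
      subst h1 h2
      exact h3
  · intro h
    exact Or.inr ⟨s v, mem_range_self v, t v, mem_range_self v, hs v, ht v, h⟩

theorem sum_vote_eq (hpref : IsWeakRanking c pref) (hs : ∀ v, c (s v) = v)
    (ht : ∀ v, c (t v) = v) : ∑ v, vote pref (t v) (s v) =
      ({v | pref (t v) (s v)}.ncard : ℝ) - {v | pref (s v) (t v)}.ncard := by
  classical
  have h : ∀ v, vote pref (t v) (s v) =
      (if pref (t v) (s v) then 1 else 0) - (if pref (s v) (t v) then 1 else 0) := fun v => by
    have hts : c (t v) = c (s v) := by rw [hs, ht]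
    by_cases h1 : pref (t v) (s v)
    · simp [vote, h1, hpref.asymm hts h1]
    · by_cases h2 : pref (s v) (t v) <;> simp [vote, h1, h2]
  simp only [h, Finset.sum_sub_distrib, Finset.sum_boole, ncard_eq_toFinset_card']
  simp

theorem isPopularCommonBase_iff (hpref : IsWeakRanking c pref)
    (hcard : ∀ I, N.Indep I → I.ncard ≤ Fintype.card V) (hd : ∀ v, c (d v) = v) :
    IsPopularCommonBase N c pref F ↔ ∃ s, IsPopularSection N c pref s ∧ F = range s := by
  have key : ∀ {s t : V → α}, IsIndepSection N c s → IsIndepSection N c t →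
      (phi c pref (range t) (range s) ≤ phi c pref (range s) (range t) ↔
        ∑ v, vote pref (t v) (s v) ≤ 0) := fun {s t} hs ht => by
    rw [sum_vote_eq hpref hs.class_eq ht.class_eq, sub_nonpos, Nat.cast_le, phi, phi]
    simp only [agentPrefers_range_iff hs.class_eq ht.class_eq,
      agentPrefers_range_iff ht.class_eq hs.class_eq]
  constructor
  · rintro ⟨hF, hpop⟩
    obtain ⟨s, hs, rfl⟩ := (commonBase_iff hcard hd).1 hF
    exact ⟨s, ⟨hs, fun t ht => (key hs ht).1 (hpop _ ((commonBase_iff hcard hd).2 ⟨t, ht, rfl⟩))⟩,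
      rfl⟩
  · rintro ⟨s, hs, rfl⟩
    refine ⟨(commonBase_iff hcard hd).2 ⟨s, hs.toIsIndepSection, rfl⟩, fun J hJ => ?_⟩
    obtain ⟨t, ht, rfl⟩ := (commonBase_iff hcard hd).1 hJ
    exact (key hs.toIsIndepSection ht).2 (hs.sum_vote_le t ht)

end CommonBases

/-! ### The exposed face and its linear description. -/

section Faces

variable {α V : Type*} [Fintype α] [Fintype V] {N : Matroid α} {c : α → V}
  {pref : α → α → Prop} {d : V → α} {𝒞 : Set (Set α)}

/-- The sum of the functionals exposes the face: if it is attained, the sum is maximal exactly where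
every inequality is tight. An empty face is exposed by convention. -/
theorem isExposed_of_forall_le {E ι : Type*} [AddCommGroup E] [Module ℝ E] [TopologicalSpace E]
    [ContinuousAdd E] [Fintype ι] {A B : Set E} (l : ι → StrongDual ℝ E) (b : ι → ℝ)
    (hle : ∀ x ∈ A, ∀ i, l i x ≤ b i) (hB : B = {x ∈ A | ∀ i, l i x = b i}) :
    IsExposed ℝ A B := by
  rintro ⟨x₀, hx₀⟩
  rw [hB] at hx₀
  refine ⟨∑ i, l i, ?_⟩
  rw [hB]
  ext x
  simp only [mem_ofPred_eq, FunLike.coe_sum, Finset.sum_apply]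
  refine and_congr_right fun hx => ⟨fun h y hy => ?_, fun h i => ?_⟩
  · rw [Finset.sum_congr rfl fun i _ => h i]
    exact Finset.sum_le_sum fun i _ => hle y hy i
  · have h1 := h x₀ hx₀.1
    rw [Finset.sum_congr rfl fun i _ => hx₀.2 i] at h1
    have h2 := Finset.sum_le_sum fun i (_ : i ∈ Finset.univ) => hle x hx i
    exact (Finset.sum_eq_sum_iff_of_le fun i _ => hle x hx i).1 (le_antisymm h2 h1) i
      (Finset.mem_univ i)

theorem matroidIntersectionPolytope_subset_indepPolyhedron (P : Matroid α) :
    matroidIntersectionPolytope P N ⊆ indepPolyhedron N :=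
  convexHull_min (by rintro _ ⟨I, hI, rfl⟩; exact incidence_mem_indepPolyhedron hI.2)
    convex_indepPolyhedron

theorem sumOn_class_le_one {x : α → ℝ}
    (hx : x ∈ matroidIntersectionPolytope (partitionMatroid c) N) (v : V) :
    sumOn x {e | c e = v} ≤ 1 := by
  refine convexHull_min (t := {y | sumOnLinear {e | c e = v} y ≤ 1}) ?_
    (convex_halfSpace_le (sumOnLinear _).isLinear 1) hx
  rintro _ ⟨I, hI, rfl⟩
  rw [mem_ofPred_eq, sumOnLinear_apply, sumOn_incidence]
  have : (I ∩ {e | c e = v}).ncard ≤ 1 := by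
    rw [ncard_le_one (Set.toFinite _)]
    rintro e ⟨he, hev⟩ f ⟨hf, hfv⟩
    exact (partitionMatroid_indep_iff c I).1 hI.1 e he f hf
      ((show c e = v from hev).trans (show c f = v from hfv).symm)
  exact_mod_cast this

theorem isExposed_certFace : IsExposed ℝ (matroidIntersectionPolytope (partitionMatroid c) N)
    (certFace N c pref 𝒞) := by
  classical
  refine isExposed_of_forall_le (ι := V ⊕ 𝒞 ⊕ {e // e ∉ certElements c pref 𝒞})
    (Sum.elim (fun v => LinearMap.toContinuousLinearMap (sumOnLinear {e | c e = v}))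
      (Sum.elim (fun C => LinearMap.toContinuousLinearMap (sumOnLinear C.1))
        fun e => - ContinuousLinearMap.proj e.1))
    (Sum.elim (fun _ => 1) (Sum.elim (fun C => rank N C.1) fun _ => 0)) ?_ ?_
  · rintro x hx (v | C | e)
    · exact sumOn_class_le_one hx v
    · exact (matroidIntersectionPolytope_subset_indepPolyhedron _ hx).2 C.1
    · simpa using (matroidIntersectionPolytope_subset_indepPolyhedron _ hx).1 e.1
  · ext x
    simp only [certFace, mem_ofPred_eq, Sum.forall, Sum.elim_inl, Sum.elim_inr, Subtype.forall,
      LinearMap.coe_toContinuousLinearMap', sumOnLinear_apply, neg_apply,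
      ContinuousLinearMap.proj_apply, neg_eq_zero]

theorem certFace_subset_certPolyhedron : certFace N c pref 𝒞 ⊆ certPolyhedron N c pref 𝒞 := by
  rintro x ⟨hx, h1, h2, h3⟩
  have h := matroidIntersectionPolytope_subset_indepPolyhedron _ hx
  exact ⟨h.1, h1, h.2, h2, h3⟩

/-- The linear system of a chain describes a hull of popular sections. -/
theorem certPolyhedron_subset_convexHull (hpref : IsWeakRanking c pref)
    (hcard : ∀ I, N.Indep I → I.ncard ≤ Fintype.card V) :
    certPolyhedron N c pref 𝒞 ⊆
      convexHull ℝ (incidence '' {F | ∃ s, IsPopularSection N c pref s ∧ F = range s}) := by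
  refine (tightFace_subset_convexHull hcard).trans (convexHull_mono (image_mono ?_))
  rintro _ ⟨s, hs, rfl, hind, htight, hsub⟩
  exact ⟨s, IsIndepSection.isPopularSection hpref ⟨hs, hind⟩ hsub htight, rfl⟩

theorem certPolyhedron_subset_certFace (hpref : IsWeakRanking c pref)
    (hcard : ∀ I, N.Indep I → I.ncard ≤ Fintype.card V) (hd : ∀ v, c (d v) = v) :
    certPolyhedron N c pref 𝒞 ⊆ certFace N c pref 𝒞 := by
  rintro x hx
  refine ⟨convexHull_mono (image_mono ?_) (certPolyhedron_subset_convexHull hpref hcard hx),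
    hx.2.1, hx.2.2.2.1, hx.2.2.2.2⟩
  rintro _ ⟨s, hs, rfl⟩
  have := (commonBase_iff hcard hd).2 ⟨s, hs.toIsIndepSection, rfl⟩
  exact ⟨this.1.indep, this.2.indep⟩

theorem IsDualCertificate.incidence_mem_certPolyhedron {s : V → α} (hs : IsIndepSection N c s)
    (h : IsDualCertificate N c pref 𝒞 (range s)) :
    incidence (range s) ∈ certPolyhedron N c pref 𝒞 := by
  have hP := incidence_mem_indepPolyhedron hs.indep
  refine ⟨hP.1, classSum_section hs, hP.2, fun C hC => ?_, fun e he => ?_⟩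
  · have := rank_closure N (range s ∩ C)
    rw [h.span_eq C hC, (hs.indep.subset inter_subset_left).rank_eq_ncard] at this
    rw [sumOn_incidence, this]
  · exact Set.indicator_of_notMem (fun hmem => he (h.subset_certElements hmem)) _

theorem certPolyhedron_eq_convexHull [Nonempty V] (hpref : IsWeakRanking c pref)
    (hpad : IsPadding N c d) :
    certPolyhedron N c pref (flatChain N (witnessSpan N c pref)) =
      convexHull ℝ (incidence '' {F | ∃ s, IsPopularSection N c pref s ∧ F = range s}) := by
  refine (certPolyhedron_subset_convexHull hpref hpad.ncard_le).antisymm ?_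
  -- `certPolyhedron` unfolds to `tightFace` with the certificate elements as allowed coordinates.
  refine convexHull_min ?_ (convex_tightFace (N := N) (c := c))
  rintro _ ⟨_, ⟨s, hs, rfl⟩, rfl⟩
  exact (hs.isDualCertificate hpref hpad).incidence_mem_certPolyhedron hs.toIsIndepSection

end Faces

/-! ### The padded instance and the projection. -/

section Padding

variable {E V : Type*} [Fintype E] [Fintype V] {M : Matroid E} {c : E → V}
  {pref : E → E → Prop} {s t : V → E ⊕ V}

theorem padMatroid_indep_iff {I : Set (E ⊕ V)} :
    (padMatroid M : Matroid (E ⊕ V)).Indep I ↔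
      M.Indep (Sum.inl ⁻¹' I) ∧ I.ncard ≤ Fintype.card V := by
  rw [padMatroid, truncation_indep_iff, Matroid.sum_indep_iff, Nat.card_eq_fintype_card]
  simp

theorem padMatroid_ground (hM : M.E = univ) : (padMatroid M : Matroid (E ⊕ V)).E = univ := by
  change (M.sum (Matroid.freeOn (univ : Set V))).E = univ
  rw [Matroid.sum_ground, hM, Matroid.freeOn_ground, image_univ, image_univ,
    range_inl_union_range_inr]

theorem isPadding_padMatroid (hM : M.E = univ) :
    IsPadding (padMatroid M : Matroid (E ⊕ V)) (padClass c) Sum.inr where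
  ground_eq := padMatroid_ground hM
  ncard_le I hI := (padMatroid_indep_iff.1 hI).2
  class_eq _ := rfl
  exchange s hs hind u v _ := by
    obtain ⟨h1, h2⟩ := padMatroid_indep_iff.1 hind
    refine padMatroid_indep_iff.2 ⟨h1.subset ?_, ?_⟩
    · rintro e (he | he)
      · cases he
      · exact he.1
    · refine (ncard_insert_le _ _).trans ?_
      rwa [ncard_sdiff_singleton_add_one (mem_range_self u) (Set.toFinite _)]
  exchange' s hs hind v hv e he hex u := by
    obtain ⟨h1, h2⟩ := padMatroid_indep_iff.1 hind
    -- Removing the dummy `s v` leaves the `M`-part unchanged, so `e` is already independent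
    -- together with the whole `M`-part of the section; only the cardinality remains to be checked.
    refine padMatroid_indep_iff.2 ⟨(padMatroid_indep_iff.1 hex).1.subset ?_, ?_⟩
    · rintro f (hf | hf)
      · exact Or.inl hf
      · refine Or.inr ⟨hf.1, ?_⟩
        rw [hv]; exact Sum.inl_ne_inr
    · refine (ncard_insert_le _ _).trans ?_
      rwa [ncard_sdiff_singleton_add_one (mem_range_self u) (Set.toFinite _)]

theorem isWeakRanking_padPref (hpref : IsWeakRanking c pref) :
    IsWeakRanking (padClass c) (padPref pref) := fun v =>
  { irrefl := by
      rintro ⟨e | u, he⟩ h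
      · exact hpref.irrefl e h
      · exact h
    trans := by
      rintro ⟨e | u, he⟩ ⟨f | w, hf⟩ ⟨g | z, hg⟩ h1 h2
      · exact hpref.trans (he.trans hf.symm) (hf.trans hg.symm) h1 h2
      all_goals first | exact trivial | exact h1.elim | exact h2.elim
    incomp_trans := by
      rintro ⟨e | u, he⟩ ⟨f | w, hf⟩ ⟨g | z, hg⟩ h1 h2
      · exact hpref.incomp_trans (he.trans hf.symm) (hf.trans hg.symm) h1 h2
      all_goals first
        | exact absurd trivial h1.1 | exact absurd trivial h1.2 | exact absurd trivial h2.1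
        | exact absurd trivial h2.2 | exact ⟨id, id⟩ }

/-- Nonemptiness of `V` matters: truncation to rank 0 would turn every element into a loop. -/
theorem padMatroid_loops_eq_empty [Nonempty V] (hM : M.E = univ) (h : M.loops = ∅) :
    (padMatroid M : Matroid (E ⊕ V)).loops = ∅ := by
  refine eq_empty_of_forall_notMem fun e he => ?_
  rw [← Matroid.isLoop_iff,
    ← Matroid.singleton_not_indep (by rw [padMatroid_ground hM]; trivial)] at he
  refine he (padMatroid_indep_iff.2 ⟨?_, by
    rw [ncard_singleton]; exact Fintype.card_pos⟩)
  rcases e with e | v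
  · have : Sum.inl ⁻¹' {(Sum.inl e : E ⊕ V)} = {e} := by ext f; simp
    rw [this]
    by_contra hl
    rw [Matroid.singleton_not_indep (by simp [hM]), Matroid.isLoop_iff, h] at hl
    exact hl
  · have : Sum.inl ⁻¹' {(Sum.inr v : E ⊕ V)} = (∅ : Set E) := by ext f; simp
    rw [this]
    exact M.empty_indep

theorem mem_range_inl_iff (hs : ∀ v, padClass c (s v) = v) {e : E} {v : V} :
    e ∈ Sum.inl ⁻¹' range s ∧ c e = v ↔ s v = Sum.inl e := by
  constructor
  · rintro ⟨⟨u, hu⟩, rfl⟩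
    have : u = c e := by rw [← hs u, hu]; rfl
    rw [← this, hu]
  · intro h
    exact ⟨⟨v, h⟩, by rw [← hs v, h]; rfl⟩

theorem agentPrefers_preimage_iff (hs : ∀ v, padClass c (s v) = v)
    (ht : ∀ v, padClass c (t v) = v) (v : V) :
    AgentPrefers c pref v (Sum.inl ⁻¹' range s) (Sum.inl ⁻¹' range t) ↔
      padPref pref (s v) (t v) := by
  have h : AgentPrefers c pref v (Sum.inl ⁻¹' range s) (Sum.inl ⁻¹' range t) ↔
      ((∃ e, s v = Sum.inl e) ∧ ¬ ∃ f, t v = Sum.inl f) ∨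
        ∃ e f, s v = Sum.inl e ∧ t v = Sum.inl f ∧ pref e f := by
    simp only [AgentPrefers, ← mem_range_inl_iff hs, ← mem_range_inl_iff ht]
    refine or_congr Iff.rfl ⟨?_, ?_⟩
    · rintro ⟨e, he, f, hf, h1, h2, h3⟩; exact ⟨e, f, ⟨he, h1⟩, ⟨hf, h2⟩, h3⟩
    · rintro ⟨e, f, ⟨he, h1⟩, ⟨hf, h2⟩, h3⟩; exact ⟨e, he, f, hf, h1, h2, h3⟩
  rw [h]
  rcases s v with e | u <;> rcases t v with f | w <;> simp [padPref]

theorem phi_preimage (hs : ∀ v, padClass c (s v) = v) (ht : ∀ v, padClass c (t v) = v) :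
    phi c pref (Sum.inl ⁻¹' range s) (Sum.inl ⁻¹' range t) =
      {v | padPref pref (s v) (t v)}.ncard := by
  simp only [phi, agentPrefers_preimage_iff hs ht]

/-- Unmatched agents take their dummies. The truncation is harmless, as a section has at most |V|
elements. -/
theorem commonIndep_iff_exists_section {I : Set E} : CommonIndep (partitionMatroid c) M I ↔
    ∃ s, IsIndepSection (padMatroid M : Matroid (E ⊕ V)) (padClass c) s ∧
      I = Sum.inl ⁻¹' range s := by
  classical
  constructor
  · rintro ⟨hP, hI⟩
    rw [partitionMatroid_indep_iff] at hP
    let s : V → E ⊕ V := fun v =>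
      if h : ∃ e ∈ I, c e = v then Sum.inl h.choose else Sum.inr v
    have hs : ∀ v, padClass c (s v) = v := fun v => by
      by_cases h : ∃ e ∈ I, c e = v
      · simp only [s, dif_pos h]; exact h.choose_spec.2
      · simp only [s, dif_neg h]; rfl
    have heq : I = Sum.inl ⁻¹' range s := by
      ext e
      constructor
      · intro he
        have h : ∃ f ∈ I, c f = c e := ⟨e, he, rfl⟩
        refine ⟨c e, ?_⟩
        simp only [s, dif_pos h]
        rw [hP _ h.choose_spec.1 e he h.choose_spec.2]
      · rintro ⟨v, hv⟩
        by_cases h : ∃ e ∈ I, c e = v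
        · simp only [s, dif_pos h, Sum.inl.injEq] at hv
          rw [← hv]; exact h.choose_spec.1
        · simp [s, dif_neg h] at hv
    refine ⟨s, ⟨hs, padMatroid_indep_iff.2 ⟨heq ▸ hI, ?_⟩⟩, heq⟩
    rw [← image_univ]
    refine (ncard_image_le (Set.toFinite _)).trans ?_
    rw [ncard_univ, Nat.card_eq_fintype_card]
  · rintro ⟨s, hs, rfl⟩
    refine ⟨?_, (padMatroid_indep_iff.1 hs.indep).1⟩
    rw [partitionMatroid_indep_iff]
    intro e he f hf hef
    have h1 := (mem_range_inl_iff hs.class_eq).1 ⟨he, rfl⟩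
    have h2 := (mem_range_inl_iff hs.class_eq).1 ⟨hf, hef.symm⟩
    exact Sum.inl_injective (h1.symm.trans h2)

theorem isPopularCommonIndep_iff (hpref : IsWeakRanking c pref) {I : Set E} :
    IsPopularCommonIndep M c pref I ↔
      ∃ s, IsPopularSection (padMatroid M : Matroid (E ⊕ V)) (padClass c) (padPref pref) s ∧
        I = Sum.inl ⁻¹' range s := by
  have key : ∀ {s t : V → E ⊕ V}, (∀ v, padClass c (s v) = v) → (∀ v, padClass c (t v) = v) →
      (phi c pref (Sum.inl ⁻¹' range t) (Sum.inl ⁻¹' range s) ≤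
        phi c pref (Sum.inl ⁻¹' range s) (Sum.inl ⁻¹' range t) ↔
        ∑ v, vote (padPref pref) (t v) (s v) ≤ 0) := fun {s t} hs ht => by
    rw [sum_vote_eq (isWeakRanking_padPref hpref) hs ht, sub_nonpos, Nat.cast_le,
      phi_preimage hs ht, phi_preimage ht hs]
  constructor
  · rintro ⟨hI, hpop⟩
    obtain ⟨s, hs, rfl⟩ := commonIndep_iff_exists_section.1 hI
    exact ⟨s, ⟨hs, fun t ht => (key hs.class_eq ht.class_eq).1
      (hpop _ (commonIndep_iff_exists_section.2 ⟨t, ht, rfl⟩))⟩, rfl⟩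
  · rintro ⟨s, hs, rfl⟩
    refine ⟨commonIndep_iff_exists_section.2 ⟨s, hs.toIsIndepSection, rfl⟩, fun J hJ => ?_⟩
    obtain ⟨t, ht, rfl⟩ := commonIndep_iff_exists_section.1 hJ
    exact (key hs.class_eq ht.class_eq).2 (hs.sum_vote_le t ht)

theorem forgetDummies_image_convexHull (A : Set (E ⊕ V → ℝ)) :
    forgetDummies '' convexHull ℝ A = convexHull ℝ (forgetDummies '' A) :=
  (LinearMap.funLeft ℝ ℝ (Sum.inl : E → E ⊕ V)).image_convexHull A

theorem forgetDummies_image_hull (hpref : IsWeakRanking c pref) :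
    forgetDummies '' convexHull ℝ (incidence '' {F | ∃ s,
      IsPopularSection (padMatroid M : Matroid (E ⊕ V)) (padClass c) (padPref pref) s ∧
        F = range s}) = popularPolytope M c pref := by
  rw [forgetDummies_image_convexHull, popularPolytope]
  congr 1
  ext x
  constructor
  · rintro ⟨_, ⟨_, ⟨s, hs, rfl⟩, rfl⟩, rfl⟩
    exact ⟨_, (isPopularCommonIndep_iff hpref).2 ⟨s, hs, rfl⟩, rfl⟩
  · rintro ⟨I, hI, rfl⟩
    obtain ⟨s, hs, rfl⟩ := (isPopularCommonIndep_iff hpref).1 hI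
    exact ⟨_, ⟨_, ⟨s, hs, rfl⟩, rfl⟩, rfl⟩

end Padding

end PopularMatroid

open PopularMatroid
theorem theorem4 {E V : Type*} [Fintype E] [Fintype V] [Nonempty V]
    (M : Matroid E) (hM : M.E = Set.univ)
    (c : E → V) (pref : E → E → Prop) (hpref : IsWeakRanking c pref) :
    ∃ 𝒞 : Set (Set (E ⊕ V)),
      IsFullChain 𝒞 ∧
      (𝒞 \ {(padMatroid M : Matroid (E ⊕ V)).loops}).ncard ≤ 2 ∧
      (M.loops = ∅ → 𝒞.ncard ≤ 2) ∧
      (∀ F : Set (E ⊕ V), IsPopularCommonBase (padMatroid M) (padClass c) (padPref pref) F →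
        IsDualCertificate (padMatroid M) (padClass c) (padPref pref) 𝒞 F) ∧
      IsExposed ℝ
        (matroidIntersectionPolytope (partitionMatroid (padClass c)) (padMatroid M))
        (certFace (padMatroid M) (padClass c) (padPref pref) 𝒞) ∧
      certFace (padMatroid M) (padClass c) (padPref pref) 𝒞 =
        certPolyhedron (padMatroid M) (padClass c) (padPref pref) 𝒞 ∧
      forgetDummies '' certFace (padMatroid M) (padClass c) (padPref pref) 𝒞 =
        popularPolytope M c pref := by
  have hpad : IsPadding (padMatroid M : Matroid (E ⊕ V)) (padClass c) Sum.inr :=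
    isPadding_padMatroid hM
  have hrank := isWeakRanking_padPref hpref
  set N : Matroid (E ⊕ V) := padMatroid M with hN
  have hface : ∀ 𝒞, certFace N (padClass c) (padPref pref) 𝒞 =
      certPolyhedron N (padClass c) (padPref pref) 𝒞 := fun 𝒞 =>
    certFace_subset_certPolyhedron.antisymm
      (certPolyhedron_subset_certFace hrank hpad.ncard_le hpad.class_eq)
  refine ⟨flatChain N (witnessSpan N (padClass c) (padPref pref)),
    isFullChain_flatChain (N.closure_closure _), ncard_flatChain_diff_le, fun hl => ?_,
    fun F hF => ?_, isExposed_certFace, hface _, ?_⟩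
  · have hloops : N.loops = ∅ := padMatroid_loops_eq_empty hM hl
    -- Without loops, the loop set is empty and already absent from the chain, so excluding it
    -- changes nothing.
    refine le_trans (le_of_eq ?_) (ncard_flatChain_diff_le (N := N)
      (C := witnessSpan N (padClass c) (padPref pref)))
    rw [Set.sdiff_singleton_eq_self]
    rw [hloops]
    exact fun h => h.2 rfl
  · obtain ⟨s, hs, rfl⟩ := (isPopularCommonBase_iff hrank hpad.ncard_le hpad.class_eq).1 hF
    exact hs.isDualCertificate hrank hpad
  · rw [hface, certPolyhedron_eq_convexHull hrank hpad]
    exact forgetDummies_image_hull hpref
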